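/- Units are $8\pi G=c=1$, signature $(-,+,+,+)$, everything is smooth, and $u(q)=u^a\partial_a q$. **Classical ideal gas (CIG).** A perfect fluid $(u,\rho,p)$ with expansion $\theta=\nabla\!\cdot u$ and acceleration $a=\nabla_u u$ that satisfies $dp+u(p)u+(\rho+p)a=0$ and $u(\rho)+(\rho+p)\theta=0$ *represents a CIG* if there are a matter density $n$, specific internal energy $\epsilon$, specific entropy $s$ and temperature $\Theta$, with $\Theta>0$ and $\rho>n>0$, such that $u(n)+n\theta=0$, $\rho=n(1+\epsilon)$, $\Theta\,ds=d\epsilon+p\,d(1/n)$, $p=\tilde k n\Theta$ and $\epsilon=c_v\Theta$ with constants $\tilde k,c_v>0$ (adiabatic index $\gamma=1+\tilde k/c_v$). A unit timelike field $u$ is a *CIG flow* if some $(u,\rho,p)$ represents a CIG (no field equations being required of $\rho,p$). **T-model.** A perfect fluid solution of Einstein's equations (with a cosmological constant $\Lambda$, possibly zero), energy density $\rho$, pressure $p$ and velocity $u=\sqrt v\,\partial_t$, on an open coordinate domain $U$ with metric $$ds^2=-\frac{dt^2}{v(t)}+\omega(t,r)^2dr^2+\varphi(t)\,C^2(dx^2+dy^2),\qquad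 C=\Big[1+\tfrac k4(x^2+y^2)\Big]^{-1},\quad k\in\{0,1,-1\},$$ $v,\varphi>0$, $\omega\neq0$. It is *homogeneous* if near every point $\omega(t,r)=F(t)G(r)$. An *ideal T-model* with parameter $\tilde\gamma>1$ is a T-model with $\Lambda=k=0$, $v=1$ (write $t=\tau$), $\varphi=|\tau|^{4/(3\tilde\gamma)}$ and $\omega=\sqrt{\varphi}\,(\alpha(\tau)+Q(r))$, where $Q'\ne0$ and $\alpha=|\tau|^{1-2/\tilde\gamma}$ if $\tilde\gamma\ne2$, $\alpha=\ln|\tau|$ if $\tilde\gamma=2$. **Theorem.** 1. If a T-model is not homogeneous, then its $(u,\rho,p)$ does not represent a CIG; moreover $u$ is not a CIG flow, so not even a comoving test CIG exists. 2. For an ideal T-model put $\pi=p/\rho$. Wherever $\rho\ne0$ and $u(\rho)\neq0$, $$\chi\equiv\frac{u(p)}{u(\rho)}=\frac{2\tilde\gamma\,\pi^2}{(\pi+1)(\pi+\tilde\gamma-1)} .$$ For no $\gamma\in\mathbb R$ is there a nonempty open subset of the model on which $\rho\ne0$, $u(\rho)\ne0$ and $\chi=\chi_c(\pi)\equiv\gamma\pi/(\pi+1)$.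 Also, for $\tilde\gamma>1$ and any $\gamma$, the two functions of $\pi$ do not coincide on any nonempty open interval. 3. Let $u$ be a geodesic unit timelike vector field with $\theta\neq0$ everywhere on a spacetime domain $U$ (an open set of $\mathbb R^4$ with a Lorentzian metric), and fix $\tilde k,c_v>0$. If $u$ is a CIG flow with these constants, then $u$ is vorticity-free and its expansion is homogeneous: near every point there is a function $t$ with $u=-dt$ and $\theta=\theta(t)$. Conversely, if $U$ is connected and $u=-dt$, $\theta=\theta(t)$ on $U$, then $u$ is a CIG flow with these constants. 4. For every T-model: (a) if $u$ is a CIG flow, its expansion is homogeneous; (b) if the expansion is homogeneous, then the evolution is barotropic, $d\rho\wedge dp=0$, and near every point the metric is either a (spatially flat) FLRW metric, $k=0$ and $\omega=\sqrt{\varphi(t)}\,G(r)$, or a Kompaneets–Chernov–Kantowski–Sachs (KCKS) metric, $\omega=F(t)G(r)$ with $F^2$ not proportional to $\varphi$; (c) conversely, if $\dot p\neq0$ and $\dot\varphi\ne0$ everywhere and $d\rho\wedge dp=0$, then the expansion is homogeneous. -/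

import Mathlib

open scoped ContDiff

namespace TModelCIG

noncomputable section

/-- Coordinates of (an open piece of) a four-dimensional spacetime. -/
abbrev E4 : Type := Fin 4 → ℝ

/-- Partial derivative with respect to the `i`-th coordinate. -/
def pd (i : Fin 4) (f : E4 → ℝ) (x : E4) : ℝ := fderiv ℝ f x (Pi.single i 1)

/-- A smooth scalar field on `U`. -/
def SmoothOn (f : E4 → ℝ) (U : Set E4) : Prop := ContDiffOn ℝ ∞ f U

/-! ### Lorentzian geometry in a coordinate domain -/

/-- `g` is a smooth metric tensor `g_{ab}` of signature `(-,+,+,+)` on the open set `U`. -/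
structure IsLorentzianOn (g : E4 → Matrix (Fin 4) (Fin 4) ℝ) (U : Set E4) : Prop where
  isOpen : IsOpen U
  smooth : ∀ a b, SmoothOn (fun x => g x a b) U
  signature : ∀ x ∈ U, ∃ P : Matrix (Fin 4) (Fin 4) ℝ, IsUnit P.det ∧
    g x = P.transpose * Matrix.diagonal ![-1, 1, 1, 1] * P

/-- Christoffel symbols `Γ^a_{bc}`. -/
def christoffel (g : E4 → Matrix (Fin 4) (Fin 4) ℝ) (a b c : Fin 4) (x : E4) : ℝ :=
  (1 / 2) * ∑ d, (g x)⁻¹ a d *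
    (pd b (fun y => g y d c) x + pd c (fun y => g y d b) x - pd d (fun y => g y b c) x)

/-- Ricci tensor
`R_{bc} = ∂_a Γ^a_{bc} - ∂_c Γ^a_{ba} + Γ^a_{ad} Γ^d_{bc} - Γ^a_{cd} Γ^d_{ba}`. -/
def ricci (g : E4 → Matrix (Fin 4) (Fin 4) ℝ) (b c : Fin 4) (x : E4) : ℝ :=
  ∑ a, (pd a (christoffel g a b c) x - pd c (christoffel g a b a) x +
    ∑ d, (christoffel g a a d x * christoffel g d b c x -
      christoffel g a c d x * christoffel g d b a x))

/-- Scalar curvature. -/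
def scalarCurv (g : E4 → Matrix (Fin 4) (Fin 4) ℝ) (x : E4) : ℝ :=
  ∑ a, ∑ b, (g x)⁻¹ a b * ricci g a b x

/-- Einstein tensor `G_{ab}`. -/
def einstein (g : E4 → Matrix (Fin 4) (Fin 4) ℝ) (a b : Fin 4) (x : E4) : ℝ :=
  ricci g a b x - (1 / 2) * scalarCurv g x * g x a b

/-- Covariant components `w_a = g_{ab} w^b`. -/
def lower (g : E4 → Matrix (Fin 4) (Fin 4) ℝ) (w : E4 → E4) (a : Fin 4) (x : E4) : ℝ :=
  ∑ b, g x a b * w x b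

/-- Directional derivative `u(q) = u^a ∂_a q`. -/
def along (u : E4 → E4) (q : E4 → ℝ) (x : E4) : ℝ := ∑ a, u x a * pd a q x

/-- Covariant derivative `∇_a u^b`. -/
def nablaUp (g : E4 → Matrix (Fin 4) (Fin 4) ℝ) (u : E4 → E4) (a b : Fin 4) (x : E4) : ℝ :=
  pd a (fun y => u y b) x + ∑ c, christoffel g b a c x * u x c

/-- Covariant derivative `∇_a u_b`. -/
def nablaDown (g : E4 → Matrix (Fin 4) (Fin 4) ℝ) (u : E4 → E4) (a b : Fin 4) (x : E4) : ℝ :=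
  pd a (lower g u b) x - ∑ c, christoffel g c a b x * lower g u c x

/-- Acceleration vector `u^a ∇_a u^b`. -/
def accel (g : E4 → Matrix (Fin 4) (Fin 4) ℝ) (u : E4 → E4) (x : E4) : E4 :=
  fun b => ∑ a, u x a * nablaUp g u a b x

/-- Expansion `θ = ∇_a u^a`. -/
def expansion (g : E4 → Matrix (Fin 4) (Fin 4) ℝ) (u : E4 → E4) (x : E4) : ℝ :=
  ∑ a, nablaUp g u a a x

/-- Projector orthogonal to `u`: `h^c_a = δ^c_a + u^c u_a`. -/
def proj (g : E4 → Matrix (Fin 4) (Fin 4) ℝ) (u : E4 → E4) (c a : Fin 4) (x : E4) : ℝ :=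
  (if c = a then 1 else 0) + u x c * lower g u a x

/-- Vorticity tensor `h^c_a h^d_b ∇_{[c} u_{d]}`. -/
def vorticity (g : E4 → Matrix (Fin 4) (Fin 4) ℝ) (u : E4 → E4) (a b : Fin 4) (x : E4) : ℝ :=
  ∑ c, ∑ d, proj g u c a x * proj g u d b x *
    ((1 / 2) * (nablaDown g u c d x - nablaDown g u d c x))

/-- `u` is a smooth timelike unit vector field on `U`. -/
structure IsUnitTimelikeOn (g : E4 → Matrix (Fin 4) (Fin 4) ℝ) (U : Set E4)
    (u : E4 → E4) : Prop where
  smooth : ∀ a, SmoothOn (fun x => u x a) U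
  unit : ∀ x ∈ U, ∑ a, ∑ b, g x a b * u x a * u x b = -1

def IsGeodesicOn (g : E4 → Matrix (Fin 4) (Fin 4) ℝ) (U : Set E4) (u : E4 → E4) : Prop :=
  ∀ x ∈ U, accel g u x = 0

def IsVorticityFreeOn (g : E4 → Matrix (Fin 4) (Fin 4) ℝ) (U : Set E4) (u : E4 → E4) : Prop :=
  ∀ x ∈ U, ∀ a b, vorticity g u a b x = 0

/-- On `V` one has `u = -dt` and `θ = f(t)`. -/
structure IsSynchronousHomogeneous (g : E4 → Matrix (Fin 4) (Fin 4) ℝ) (V : Set E4)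
    (u : E4 → E4) (t : E4 → ℝ) (f : ℝ → ℝ) : Prop where
  smooth_t : SmoothOn t V
  smooth_f : ContDiffOn ℝ ∞ f (t '' V)
  eq_neg_dt : ∀ x ∈ V, ∀ a, lower g u a x = - pd a t x
  expansion_eq : ∀ x ∈ V, expansion g u x = f (t x)

/-- Homogeneous expansion: around every point there is a time function `t` with `u = -dt`
and `θ = θ(t)`. -/
def HasHomogeneousExpansionOn (g : E4 → Matrix (Fin 4) (Fin 4) ℝ) (U : Set E4)
    (u : E4 → E4) : Prop :=
  ∀ x ∈ U, ∃ V : Set E4, IsOpen V ∧ x ∈ V ∧ V ⊆ U ∧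
    ∃ (t : E4 → ℝ) (f : ℝ → ℝ), IsSynchronousHomogeneous g V u t f

/-! ### Perfect fluids, local thermal equilibrium, classical ideal gases -/

/-- Conservation of `T = (ρ + p) u ⊗ u + p g`:
`dp + u(p) u + (ρ + p) a = 0` and `u(ρ) + (ρ + p) θ = 0`. -/
structure IsPerfectEnergyTensor (g : E4 → Matrix (Fin 4) (Fin 4) ℝ) (U : Set E4)
    (u : E4 → E4) (ρ p : E4 → ℝ) : Prop where
  smooth_ρ : SmoothOn ρ U
  smooth_p : SmoothOn p U
  momentum : ∀ x ∈ U, ∀ a, pd a p x + along u p x * lower g u a x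
    + (ρ x + p x) * lower g (accel g u) a x = 0
  energy : ∀ x ∈ U, along u ρ x + (ρ x + p x) * expansion g u x = 0

/-- `{n, ε, s, Θ}` is a thermodynamic scheme for `(u, ρ, p)` on `U`: matter conservation
`u(n) + n θ = 0`, energy decomposition `ρ = n (1 + ε)`, and the thermodynamic relation
`Θ ds = dε + p d(1/n)`; positivity `Θ > 0`, `ρ > n > 0`. -/
structure IsThermodynamicScheme (g : E4 → Matrix (Fin 4) (Fin 4) ℝ) (U : Set E4)
    (u : E4 → E4) (ρ p n ε s Θ : E4 → ℝ) : Prop where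
  smooth_n : SmoothOn n U
  smooth_ε : SmoothOn ε U
  smooth_s : SmoothOn s U
  smooth_Θ : SmoothOn Θ U
  n_pos : ∀ x ∈ U, 0 < n x
  n_lt_ρ : ∀ x ∈ U, n x < ρ x
  Θ_pos : ∀ x ∈ U, 0 < Θ x
  matter : ∀ x ∈ U, along u n x + n x * expansion g u x = 0
  decomposition : ∀ x ∈ U, ρ x = n x * (1 + ε x)
  first_law : ∀ x ∈ U, ∀ a, Θ x * pd a s x = pd a ε x + p x * pd a (fun y => 1 / n y) x

/-- The perfect fluid `(u, ρ, p)` on `U` represents the evolution in local thermal equilibrium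
of a classical ideal gas: equations of state `p = kt n Θ` and `ε = cv Θ`. The adiabatic index
is `γ = 1 + kt / cv`. -/
def RepresentsCIG (kt cv : ℝ) (g : E4 → Matrix (Fin 4) (Fin 4) ℝ) (U : Set E4)
    (u : E4 → E4) (ρ p : E4 → ℝ) : Prop :=
  IsPerfectEnergyTensor g U u ρ p ∧ ∃ n ε s Θ : E4 → ℝ,
    IsThermodynamicScheme g U u ρ p n ε s Θ ∧
    (∀ x ∈ U, p x = kt * n x * Θ x) ∧ (∀ x ∈ U, ε x = cv * Θ x)

/-- `u` is the unit velocity of a (possibly test) classical ideal gas on `U`. -/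
def IsCIGFlow (kt cv : ℝ) (g : E4 → Matrix (Fin 4) (Fin 4) ℝ) (U : Set E4)
    (u : E4 → E4) : Prop :=
  ∃ ρ p : E4 → ℝ, RepresentsCIG kt cv g U u ρ p

/-- Barotropic evolution: `dρ ∧ dp = 0`. -/
def IsBarotropicOn (U : Set E4) (ρ p : E4 → ℝ) : Prop :=
  ∀ x ∈ U, ∀ a b, pd a ρ x * pd b p x - pd b ρ x * pd a p x = 0

/-- Einstein equations `G + Λ g = (ρ + p) u ⊗ u + p g` (units `8πG = c = 1`). -/
def SolvesEinsteinPerfectFluid (Λ : ℝ) (g : E4 → Matrix (Fin 4) (Fin 4) ℝ) (U : Set E4)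
    (u : E4 → E4) (ρ p : E4 → ℝ) : Prop :=
  ∀ x ∈ U, ∀ a b, einstein g a b x + Λ * g x a b =
    (ρ x + p x) * lower g u a x * lower g u b x + p x * g x a b

/-! ### T-models -/

/-- In coordinates `(t, r, x, y)`, the metric
`-dt²/v(t) + w(t,r)² dr² + φ(t) C² (dx² + dy²)`, `C = (1 + k (x² + y²)/4)⁻¹`. -/
def tMetric (k : ℝ) (v φ : ℝ → ℝ) (w : ℝ → ℝ → ℝ) (x : E4) : Matrix (Fin 4) (Fin 4) ℝ :=
  let C : ℝ := (1 + k / 4 * (x 2 ^ 2 + x 3 ^ 2))⁻¹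
  Matrix.diagonal ![-(1 / v (x 0)), w (x 0) (x 1) ^ 2, φ (x 0) * C ^ 2, φ (x 0) * C ^ 2]

/-- The comoving unit velocity `√v ∂_t`. -/
def tVelocity (v : ℝ → ℝ) (x : E4) : E4 := Pi.single 0 (Real.sqrt (v (x 0)))

/-- A T-model on the coordinate domain `U`, with energy density `ρ` and pressure `p`: a perfect
fluid solution of the Einstein equations, comoving with the coordinates, whose metric is
`tMetric k v φ w`. -/
structure IsTModel (Λ k : ℝ) (v φ : ℝ → ℝ) (w : ℝ → ℝ → ℝ) (U : Set E4)
    (ρ p : E4 → ℝ) : Prop where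
  isOpen : IsOpen U
  k_mem : k = 0 ∨ k = 1 ∨ k = -1
  C_ne : ∀ x ∈ U, 1 + k / 4 * (x 2 ^ 2 + x 3 ^ 2) ≠ 0
  v_pos : ∀ x ∈ U, 0 < v (x 0)
  φ_pos : ∀ x ∈ U, 0 < φ (x 0)
  w_ne : ∀ x ∈ U, w (x 0) (x 1) ≠ 0
  smooth_v : SmoothOn (fun x => v (x 0)) U
  smooth_φ : SmoothOn (fun x => φ (x 0)) U
  smooth_w : SmoothOn (fun x => w (x 0) (x 1)) U
  einstein_eq : SolvesEinsteinPerfectFluid Λ (tMetric k v φ w) U (tVelocity v) ρ p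

/-- The T-model is (spatially) homogeneous on `U`: around every point `w` factorises as
`F(t) G(r)`, so that the coordinate `r` can be changed to have `w = w(t)`. -/
def IsHomogeneousTModel (w : ℝ → ℝ → ℝ) (U : Set E4) : Prop :=
  ∀ x ∈ U, ∃ W : Set E4, IsOpen W ∧ x ∈ W ∧ W ⊆ U ∧
    ∃ F G : ℝ → ℝ, ∀ y ∈ W, w (y 0) (y 1) = F (y 0) * G (y 1)

/-- On `W`, after the change `dR = G(r) dr`, the metric is the spatially flat FLRW metric
`-dt²/v(t) + φ(t) (dR² + dx² + dy²)`. -/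
def IsFLRWForm (k : ℝ) (φ : ℝ → ℝ) (w : ℝ → ℝ → ℝ) (W : Set E4) : Prop :=
  k = 0 ∧ ∃ G : ℝ → ℝ, ∀ y ∈ W, w (y 0) (y 1) = Real.sqrt (φ (y 0)) * G (y 1)

/-- On `W`, after the change `dR = G(r) dr`, the metric is the homogeneous and anisotropic
Kompaneets-Chernov-Kantowski-Sachs metric `-dt²/v(t) + F(t)² dR² + φ(t) C² (dx² + dy²)`,
with `F²` not proportional to `φ`. -/
def IsKCKSForm (φ : ℝ → ℝ) (w : ℝ → ℝ → ℝ) (W : Set E4) : Prop :=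
  ∃ F G : ℝ → ℝ, (∀ y ∈ W, w (y 0) (y 1) = F (y 0) * G (y 1)) ∧
    ¬ ∃ c : ℝ, ∀ y ∈ W, F (y 0) ^ 2 = c * φ (y 0)

/-! ### Ideal T-models and the two indicatrix functions -/

/-- `φ(τ) = |τ|^{4/(3γ')}`. -/
def idealφ (γ' : ℝ) (τ : ℝ) : ℝ := |τ| ^ (4 / (3 * γ'))

/-- `α(τ) = |τ|^{1 - 2/γ'}` if `γ' ≠ 2`, and `ln |τ|` if `γ' = 2`. -/
def idealα (γ' : ℝ) (τ : ℝ) : ℝ :=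
  if γ' = 2 then Real.log |τ| else |τ| ^ (1 - 2 / γ')

/-- `w(τ,r) = √φ(τ) (α(τ) + Q(r))`. -/
def idealw (γ' : ℝ) (Q : ℝ → ℝ) (τ r : ℝ) : ℝ :=
  Real.sqrt (idealφ γ' τ) * (idealα γ' τ + Q r)

/-- The (inhomogeneous) ideal T-model with parameter `γ' > 1` and inhomogeneity function `Q`,
`Q' ≠ 0`: the T-model with metric `-dτ² + φ(τ) ([α(τ) + Q(r)]² dr² + dx² + dy²)`. -/
structure IsIdealTModel (γ' : ℝ) (Q : ℝ → ℝ) (U : Set E4) (ρ p : E4 → ℝ) : Prop where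
  one_lt : 1 < γ'
  isTModel : IsTModel 0 0 (fun _ => 1) (idealφ γ') (idealw γ' Q) U ρ p
  Q_deriv_ne : ∀ x ∈ U, deriv Q (x 1) ≠ 0

/-- Indicatrix function of an ideal T-model. -/
def chiIdealT (γ' π : ℝ) : ℝ := 2 * γ' * π ^ 2 / ((π + 1) * (π + γ' - 1))

/-- Indicatrix function of a classical ideal gas with adiabatic index `γ`. -/
def chiCIG (γ π : ℝ) : ℝ := γ * π / (π + 1)

end

end TModelCIG

namespace TModelCIG

/-! ### Coordinate calculus of scalar fields -/

open Filter Topology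

/-! The equations of state eliminate `ε` and `Θ`: ρ = n + (cv/kt) p. Matter conservation removes n
from the energy equation and leaves u(p) = -γ p θ. In geodesic motion the momentum equation then
reads d log p = γ θ u, with u taken as a 1-form (`IsCIGFlow.exists_log_pressure`). Hence θu is
closed.

For a unit field, contracting u with du gives the acceleration (`lower_accel`). Contracting dθ ∧ u +
θ du = 0 with a geodesic u therefore makes dθ collinear with u, and du = 0 follows where θ ≠ 0. The
Poincaré lemma and the inverse function theorem turn this into u = -dt, θ = θ(t). Conversely, with T
a primitive of θ(t), the isentropic choice n = exp(-T), Θ = exp(-(γ-1)T) is an ideal gas.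

The flow of a T-model is geodesic. Put A = ∂_t log ω and B = (1/2) ∂_t log φ, so that θ = √v (A +
2B). As u has no r-component, ∂_r log p = 0 for any comoving gas; commuting derivatives gives ∂_r A
= 0, even where θ vanishes. This condition is equivalent to homogeneous expansion and forces ω =
F(t)G(r) locally. Einstein's equations make p a function of time and give ∂_r ρ = 2vB ∂_r A, which
settles barotropy. If F² is proportional to φ then A = B, and the two field equations for p agree
only when k = 0.

In an ideal T-model p is a multiple of 1/τ², ρ' = -(ρ+p)θ, and p + (γ'-1)ρ is a multiple of θ/τ;
together these yield χ. Equating it with χ_c gives a linear equation for π, so π would be constant;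
but p does not depend on r while ρ does, through Q. -/

theorem SmoothOn.contDiffAt {f : E4 → ℝ} {U : Set E4} (hf : SmoothOn f U) (hU : IsOpen U)
    {x : E4} (hx : x ∈ U) : ContDiffAt ℝ ∞ f x :=
  ContDiffOn.contDiffAt hf (hU.mem_nhds hx)

theorem SmoothOn.differentiableAt {f : E4 → ℝ} {U : Set E4} (hf : SmoothOn f U) (hU : IsOpen U)
    {x : E4} (hx : x ∈ U) : DifferentiableAt ℝ f x :=
  (hf.contDiffAt hU hx).differentiableAt (by simp)

theorem SmoothOn.pd {f : E4 → ℝ} {U : Set E4} (hf : SmoothOn f U) (hU : IsOpen U) (i : Fin 4) :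
    SmoothOn (pd i f) U := by
  have h : ContDiffOn ℝ ∞ (fderiv ℝ f) U := ContDiffOn.fderiv_of_isOpen hf hU (by simp)
  exact h.clm_apply contDiffOn_const

theorem pd_congr {f g : E4 → ℝ} {x : E4} (h : f =ᶠ[𝓝 x] g) (i : Fin 4) : pd i f x = pd i g x := by
  simp only [pd, h.fderiv_eq]

theorem pd_congr_on {f g : E4 → ℝ} {U : Set E4} (hU : IsOpen U) (h : ∀ y ∈ U, f y = g y)
    {x : E4} (hx : x ∈ U) (i : Fin 4) : pd i f x = pd i g x :=
  pd_congr (Filter.eventually_of_mem (hU.mem_nhds hx) h) i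

theorem SmoothOn.congr {f g : E4 → ℝ} {U : Set E4} (hf : SmoothOn f U)
    (h : ∀ y ∈ U, g y = f y) : SmoothOn g U :=
  ContDiffOn.congr hf h

@[simp] theorem pd_const (c : ℝ) (i : Fin 4) (x : E4) : pd i (fun _ => c) x = 0 := by
  simp [pd]

theorem pd_add {f g : E4 → ℝ} {x : E4} (hf : DifferentiableAt ℝ f x) (hg : DifferentiableAt ℝ g x)
    (i : Fin 4) : pd i (fun y => f y + g y) x = pd i f x + pd i g x := by
  simp [pd, fderiv_fun_add hf hg]

theorem pd_neg (f : E4 → ℝ) (x : E4) (i : Fin 4) : pd i (fun y => - f y) x = - pd i f x := by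
  simp [pd, fderiv_fun_neg]

theorem pd_mul {f g : E4 → ℝ} {x : E4} (hf : DifferentiableAt ℝ f x) (hg : DifferentiableAt ℝ g x)
    (i : Fin 4) : pd i (fun y => f y * g y) x = pd i f x * g x + f x * pd i g x := by
  simp [pd, fderiv_fun_mul hf hg]; ring

theorem pd_const_mul {f : E4 → ℝ} {x : E4} (hf : DifferentiableAt ℝ f x) (c : ℝ) (i : Fin 4) :
    pd i (fun y => c * f y) x = c * pd i f x := by
  rw [pd_mul (by fun_prop) hf]; simp

theorem pd_comp {h : ℝ → ℝ} {h' : ℝ} {f : E4 → ℝ} {x : E4} (hh : HasDerivAt h h' (f x))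
    (hf : DifferentiableAt ℝ f x) (i : Fin 4) :
    pd i (fun y => h (f y)) x = h' * pd i f x := by
  have := (hh.comp_hasFDerivAt x hf.hasFDerivAt).fderiv
  simp only [pd]
  change (fderiv ℝ (h ∘ f) x) _ = _
  rw [this]; simp

theorem pd_sq {f : E4 → ℝ} {x : E4} (hf : DifferentiableAt ℝ f x) (i : Fin 4) :
    pd i (fun y => f y ^ 2) x = 2 * f x * pd i f x := by
  have := pd_comp (h := fun z => z ^ 2) (by simpa using hasDerivAt_pow 2 (f x)) hf i
  simpa using this

theorem pd_inv {f : E4 → ℝ} {x : E4} (hf : DifferentiableAt ℝ f x) (h0 : f x ≠ 0) (i : Fin 4) :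
    pd i (fun y => (f y)⁻¹) x = - pd i f x / f x ^ 2 := by
  rw [pd_comp (h := fun z => z⁻¹) (hasDerivAt_inv h0) hf i]; ring

theorem pd_div {f g : E4 → ℝ} {x : E4} (hf : DifferentiableAt ℝ f x) (hg : DifferentiableAt ℝ g x)
    (h0 : g x ≠ 0) (i : Fin 4) :
    pd i (fun y => f y / g y) x = (pd i f x * g x - f x * pd i g x) / g x ^ 2 := by
  simp only [div_eq_mul_inv]
  rw [pd_mul hf (hg.fun_inv h0), pd_inv hg h0]
  field_simp
  ring

theorem pd_log {f : E4 → ℝ} {x : E4} (hf : DifferentiableAt ℝ f x) (h0 : f x ≠ 0) (i : Fin 4) :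
    pd i (fun y => Real.log (f y)) x = pd i f x / f x := by
  rw [pd_comp (Real.hasDerivAt_log h0) hf i]; ring

theorem pd_sqrt {f : E4 → ℝ} {x : E4} (hf : DifferentiableAt ℝ f x) (h0 : 0 < f x) (i : Fin 4) :
    pd i (fun y => Real.sqrt (f y)) x = pd i f x / (2 * Real.sqrt (f x)) := by
  rw [pd_comp (Real.hasDerivAt_sqrt h0.ne') hf i]; ring

theorem pd_coord (i j : Fin 4) (x : E4) :
    pd i (fun y : E4 => y j) x = if i = j then 1 else 0 := by
  have : HasFDerivAt (fun y : E4 => y j) (ContinuousLinearMap.proj (R := ℝ) j) x :=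
    (ContinuousLinearMap.proj (R := ℝ) (φ := fun _ : Fin 4 => ℝ) j).hasFDerivAt
  simp only [pd, this.fderiv]
  simp [Pi.single_apply, eq_comm]

theorem pd_comm {f : E4 → ℝ} {U : Set E4} (hf : SmoothOn f U) (hU : IsOpen U) {x : E4}
    (hx : x ∈ U) (i j : Fin 4) : pd i (pd j f) x = pd j (pd i f) x := by
  have hc := hf.contDiffAt hU hx
  have hs : IsSymmSndFDerivAt ℝ f x := hc.isSymmSndFDerivAt (by simp; exact WithTop.coe_le_coe.2 le_top)
  have hd : DifferentiableAt ℝ (fderiv ℝ f) x :=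
    (ContDiffAt.fderiv_right hc (m := 1) (WithTop.coe_le_coe.2 le_top)).differentiableAt (by simp)
  have key : ∀ a b : Fin 4, pd a (pd b f) x
      = fderiv ℝ (fderiv ℝ f) x (Pi.single a 1) (Pi.single b 1) := by
    intro a b
    have : HasFDerivAt (pd b f) ((fderiv ℝ (fderiv ℝ f) x).flip (Pi.single b 1)) x := by
      have := hd.hasFDerivAt.clm_apply (hasFDerivAt_const (Pi.single b (1:ℝ) : E4) x)
      rw [ContinuousLinearMap.comp_zero, zero_add] at this
      exact this
    change fderiv ℝ (pd b f) x _ = _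
    rw [this.fderiv]; simp
  rw [key, key]
  exact hs _ _

theorem fderiv_eq_sum_pd (f : E4 → ℝ) (x v : E4) : fderiv ℝ f x v = ∑ i, v i * pd i f x := by
  conv_lhs => rw [← Finset.univ_sum_single v]
  rw [map_sum]
  refine Finset.sum_congr rfl fun i _ => ?_
  have : (Pi.single i (v i) : E4) = v i • Pi.single i (1 : ℝ) := by
    simp [← Pi.single_smul]
  rw [this, map_smul]; rfl

/-- Passage to one-variable calculus along a coordinate line, where uniqueness of derivatives can be
used. -/
theorem pd_eq_deriv_update {f : E4 → ℝ} {x : E4} (hf : DifferentiableAt ℝ f x) (i : Fin 4) :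
    HasDerivAt (fun s => f (Function.update x i s)) (pd i f x) (x i) := by
  have h1 : HasDerivAt (fun s => Function.update x i s) (Pi.single i (1 : ℝ)) (x i) :=
    hasDerivAt_update x i (x i)
  have h2 : HasFDerivAt f (fderiv ℝ f x) (Function.update x i (x i)) := by
    simpa using hf.hasFDerivAt
  exact h2.comp_hasDerivAt (x i) h1

/-- A field that is locally constant along the `i`-th coordinate line has vanishing `i`-th partial
derivative. -/
theorem pd_eq_zero_of_line {f : E4 → ℝ} {U : Set E4} (hU : IsOpen U) {x : E4} (hx : x ∈ U)
    (i : Fin 4) (h : ∀ y ∈ U, (∀ j, j ≠ i → y j = x j) → f y = f x) : pd i f x = 0 := by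
  by_cases hf : DifferentiableAt ℝ f x
  · refine (pd_eq_deriv_update hf i).unique ?_
    have hc : ContinuousAt (fun s => Function.update x i s) (x i) := by fun_prop
    have : ∀ᶠ s in 𝓝 (x i), Function.update x i s ∈ U := by
      apply hc.eventually_mem
      simpa using hU.mem_nhds hx
    refine (hasDerivAt_const (x i) (f x)).congr_of_eventuallyEq ?_
    filter_upwards [this] with s hs
    exact h _ hs fun j hj => by simp [hj]
  -- Where `f` is not differentiable, `fderiv` is zero by convention.
  · simp [pd, fderiv_zero_of_not_differentiableAt hf]

/-- On a ball, a field whose partial derivatives along the directions in which `y` and `z` differ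
vanish takes the same value at `y` and `z`. -/
theorem eq_of_pd_eq_zero {f : E4 → ℝ} {x : E4} {r : ℝ}
    (hf : ∀ y ∈ Metric.ball x r, DifferentiableAt ℝ f y) {y z : E4} (hy : y ∈ Metric.ball x r)
    (hz : z ∈ Metric.ball x r)
    (h : ∀ i, y i ≠ z i → ∀ q ∈ Metric.ball x r, pd i f q = 0) : f y = f z := by
  have hseg : ∀ s ∈ Set.Icc (0:ℝ) 1, AffineMap.lineMap y z s ∈ Metric.ball x r := fun s hs =>
    (convex_ball x r).lineMap_mem hy hz hs
  have hd : ∀ s ∈ Set.Icc (0:ℝ) 1, HasDerivAt (fun s => f (AffineMap.lineMap y z s)) 0 s := by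
    intro s hs
    have h1 : HasDerivAt (fun s : ℝ => AffineMap.lineMap y z s) (z - y) s :=
      AffineMap.hasDerivAt_lineMap
    have h2 := (hf _ (hseg s hs)).hasFDerivAt.comp_hasDerivAt s h1
    have h3 : fderiv ℝ f (AffineMap.lineMap y z s) (z - y) = 0 := by
      rw [fderiv_eq_sum_pd]
      refine Finset.sum_eq_zero fun i _ => ?_
      by_cases hi : y i = z i
      · simp [hi]
      · rw [h i hi _ (hseg s hs), mul_zero]
    rw [h3] at h2
    exact h2
  have := constant_of_derivWithin_zero (f := fun s => f (AffineMap.lineMap y z s)) (a := 0) (b := 1)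
    (fun s hs => (hd s hs).differentiableAt.differentiableWithinAt)
    (fun s hs => ((hd s ⟨hs.1, hs.2.le⟩).hasDerivWithinAt).derivWithin
      (uniqueDiffOn_Icc zero_lt_one s ⟨hs.1, hs.2.le⟩)) 1 (by simp)
  simpa using this.symm

/-- Balls of `E4` are boxes, the distance being the sup distance, so the coordinates of two points
of a ball may be mixed. This is what lets a ball serve as a product neighbourhood in t and r. -/
theorem update_mem_ball {x y z : E4} {r : ℝ} (hy : y ∈ Metric.ball x r) (hz : z ∈ Metric.ball x r)
    (i : Fin 4) : Function.update y i (z i) ∈ Metric.ball x r := by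
  have hr : 0 < r := (dist_nonneg.trans_lt (Metric.mem_ball.1 hy))
  rw [Metric.mem_ball, dist_pi_lt_iff hr] at *
  intro j
  by_cases hj : j = i
  · subst hj; simpa using hz j
  · simpa [hj] using hy j

theorem smoothOn_coord (i : Fin 4) (U : Set E4) : SmoothOn (fun x => x i) U :=
  (contDiff_apply ℝ ℝ i).contDiffOn

theorem SmoothOn.mono {f : E4 → ℝ} {U V : Set E4} (hf : SmoothOn f U) (h : V ⊆ U) : SmoothOn f V :=
  ContDiffOn.mono hf h

theorem smoothOn_const (c : ℝ) (U : Set E4) : SmoothOn (fun _ => c) U := contDiffOn_const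

theorem SmoothOn.add {f g : E4 → ℝ} {U : Set E4} (hf : SmoothOn f U) (hg : SmoothOn g U) :
    SmoothOn (fun x => f x + g x) U := ContDiffOn.add hf hg

theorem SmoothOn.sub {f g : E4 → ℝ} {U : Set E4} (hf : SmoothOn f U) (hg : SmoothOn g U) :
    SmoothOn (fun x => f x - g x) U := ContDiffOn.sub hf hg

theorem SmoothOn.mul {f g : E4 → ℝ} {U : Set E4} (hf : SmoothOn f U) (hg : SmoothOn g U) :
    SmoothOn (fun x => f x * g x) U := ContDiffOn.mul hf hg

theorem SmoothOn.div {f g : E4 → ℝ} {U : Set E4} (hf : SmoothOn f U) (hg : SmoothOn g U)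
    (h : ∀ x ∈ U, g x ≠ 0) : SmoothOn (fun x => f x / g x) U := ContDiffOn.div hf hg h

theorem SmoothOn.sqrt {f : E4 → ℝ} {U : Set E4} (hf : SmoothOn f U) (h : ∀ x ∈ U, f x ≠ 0) :
    SmoothOn (fun x => Real.sqrt (f x)) U := ContDiffOn.sqrt hf h

theorem SmoothOn.log {f : E4 → ℝ} {U : Set E4} (hf : SmoothOn f U) (h : ∀ x ∈ U, f x ≠ 0) :
    SmoothOn (fun x => Real.log (f x)) U := ContDiffOn.log hf h

theorem SmoothOn.sum {ι : Type*} {s : Finset ι} {f : ι → E4 → ℝ} {U : Set E4}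
    (hf : ∀ i ∈ s, SmoothOn (f i) U) : SmoothOn (fun x => ∑ i ∈ s, f i x) U :=
  ContDiffOn.sum hf

/-! ### Local functional dependence and the Poincaré lemma -/

/-- The differential of the coordinate change that replaces the `i`-th coordinate by a function
whose differential is `l`. -/
noncomputable def replaceCoord (l : E4 →L[ℝ] ℝ) (i : Fin 4) : E4 →L[ℝ] E4 :=
  ContinuousLinearMap.id ℝ E4 +
    (l - ContinuousLinearMap.proj i).smulRight (Pi.single i (1 : ℝ))

theorem replaceCoord_apply (l : E4 →L[ℝ] ℝ) (i : Fin 4) (v : E4) :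
    replaceCoord l i v = Function.update v i (l v) := by
  funext j
  by_cases h : j = i
  · subst h; simp [replaceCoord]
  · simp [replaceCoord, h]

theorem exists_equiv_replaceCoord (l : E4 →L[ℝ] ℝ) (i : Fin 4) (h : l (Pi.single i 1) ≠ 0) :
    ∃ L : E4 ≃L[ℝ] E4, (L : E4 →L[ℝ] E4) = replaceCoord l i := by
  have inj : Function.Injective (replaceCoord l i).toLinearMap := by
    rw [← LinearMap.ker_eq_bot, LinearMap.ker_eq_bot']
    intro v hv
    replace hv : replaceCoord l i v = 0 := hv
    rw [replaceCoord_apply] at hv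
    have h1 : l v = 0 := by simpa using congrFun hv i
    -- A kernel vector has only an i-th entry, which `l` multiplies by the nonzero number `l
    -- (Pi.single i 1)`.
    have h2 : v = v i • (Pi.single i 1 : E4) := by
      funext j
      by_cases hj : j = i
      · subst hj; simp
      · simpa [hj] using congrFun hv j
    rw [h2, map_smul, smul_eq_mul] at h1
    rw [h2, (mul_eq_zero.1 h1).resolve_right h, zero_smul]
  refine ⟨(LinearEquiv.ofInjectiveEndo _ inj).toContinuousLinearEquiv, ?_⟩
  ext v j
  simp

/-- If `dt ≠ 0` and `dq` is proportional to `dt`, then `q` is locally a smooth function of `t`. -/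
theorem exists_eq_comp_of_pd_proportional {t q : E4 → ℝ} {U : Set E4} (hU : IsOpen U)
    (ht : SmoothOn t U) (hq : SmoothOn q U) {x : E4} (hx : x ∈ U) (h0 : ∃ i, pd i t x ≠ 0)
    (hpar : ∀ y ∈ U, ∃ c : ℝ, ∀ a, pd a q y = c * pd a t y) :
    ∃ V : Set E4, IsOpen V ∧ x ∈ V ∧ V ⊆ U ∧ ∃ f : ℝ → ℝ,
      ContDiffOn ℝ ∞ f (t '' V) ∧ ∀ y ∈ V, q y = f (t y) := by
  obtain ⟨i, hi⟩ := h0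
  set U' : Set E4 := U ∩ pd i t ⁻¹' {0}ᶜ with hU'
  have hU'o : IsOpen U' :=
    (ht.pd hU i).continuousOn.isOpen_inter_preimage hU isOpen_compl_singleton
  have hxU' : x ∈ U' := ⟨hx, hi⟩
  have ht' : SmoothOn t U' := ht.mono Set.inter_subset_left
  have hq' : SmoothOn q U' := hq.mono Set.inter_subset_left
  -- Straightening of `t`: where ∂_i t ≠ 0, using `t` as the i-th coordinate is a local
  -- diffeomorphism. In the new chart `q` turns out to depend on that coordinate only.
  set Φ : E4 → E4 := fun y => Function.update y i (t y) with hΦ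
  have hΦc : ∀ y ∈ U', ContDiffAt ℝ ∞ Φ y := by
    intro y hy
    rw [contDiffAt_pi]
    intro j
    by_cases hj : j = i
    · subst hj; simpa [hΦ] using ht'.contDiffAt hU'o hy
    · simpa [hΦ, hj] using (smoothOn_coord j U').contDiffAt hU'o hy
  have hΦd : ∀ y ∈ U', ∃ L : E4 ≃L[ℝ] E4, HasFDerivAt Φ (L : E4 →L[ℝ] E4) y := by
    intro y hy
    obtain ⟨L, hL⟩ := exists_equiv_replaceCoord (fderiv ℝ t y) i hy.2
    refine ⟨L, ?_⟩
    rw [hL, hasFDerivAt_pi']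
    intro j
    by_cases hj : j = i
    · subst hj
      have := (ht'.differentiableAt hU'o hy).hasFDerivAt
      convert! this using 1
      · funext z; simp [hΦ]
      · ext v; simp [replaceCoord_apply]
    · have : HasFDerivAt (fun y : E4 => y j) (ContinuousLinearMap.proj (R := ℝ) j) y :=
        (ContinuousLinearMap.proj (R := ℝ) (φ := fun _ : Fin 4 => ℝ) j).hasFDerivAt
      convert! this using 1
      · funext z; simp [hΦ, hj]
      · ext v; simp [replaceCoord_apply, hj]
  obtain ⟨L, hL⟩ := hΦd x hxU'
  set e := (hΦc x hxU').toOpenPartialHomeomorph Φ hL (by simp) with he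
  have hex : x ∈ e.source := (hΦc x hxU').mem_toOpenPartialHomeomorph_source hL (by simp)
  have hecoe : ∀ y, e y = Φ y := fun y => rfl
  have hTo : IsOpen (e.target ∩ e.symm ⁻¹' U') := e.isOpen_inter_preimage_symm hU'o
  have hΦx : Φ x ∈ e.target ∩ e.symm ⁻¹' U' := by
    refine ⟨e.map_source hex, ?_⟩
    change e.symm (e x) ∈ U'
    rwa [e.left_inv hex]
  obtain ⟨r, hr, hball⟩ := Metric.isOpen_iff.1 hTo _ hΦx
  have hsymm : ∀ z ∈ Metric.ball (Φ x) r, ContDiffAt ℝ ∞ e.symm z := by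
    intro z hz
    obtain ⟨L', hL'⟩ := hΦd _ (hball hz).2
    exact e.contDiffAt_symm (hball hz).1 hL' (hΦc _ (hball hz).2)
  have hQ : ∀ z ∈ Metric.ball (Φ x) r, ContDiffAt ℝ ∞ (fun z => q (e.symm z)) z := fun z hz =>
    (hq'.contDiffAt hU'o (hball hz).2).comp z (hsymm z hz)
  have hQd : ∀ j, j ≠ i → ∀ z ∈ Metric.ball (Φ x) r, pd j (fun z => q (e.symm z)) z = 0 := by
    intro j hj z hz
    have hs := ((hsymm z hz).differentiableAt (by simp)).hasFDerivAt
    have hqz := ((hq'.differentiableAt hU'o (hball hz).2).hasFDerivAt.comp z hs).fderiv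
    have htz := ((ht'.differentiableAt hU'o (hball hz).2).hasFDerivAt.comp z hs).fderiv
    have h1 : pd j (t ∘ e.symm) z = 0 := by
      have : t ∘ e.symm =ᶠ[𝓝 z] fun z => z i := by
        filter_upwards [e.open_target.mem_nhds (hball hz).1] with w hw
        have := congrFun (e.right_inv hw) i
        rw [hecoe] at this
        simpa [hΦ] using this
      rw [pd_congr this, pd_coord, if_neg hj]
    obtain ⟨c, hc⟩ := hpar _ (hball hz).2.1
    have h2 : ∀ v, fderiv ℝ q (e.symm z) v = c * fderiv ℝ t (e.symm z) v := by
      intro v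
      rw [fderiv_eq_sum_pd, fderiv_eq_sum_pd, Finset.mul_sum]
      exact Finset.sum_congr rfl fun a _ => by rw [hc]; ring
    change pd j (q ∘ e.symm) z = 0
    simp only [pd] at h1 ⊢
    rw [htz] at h1
    rw [hqz]
    simp only [ContinuousLinearMap.comp_apply] at h1 ⊢
    rw [h2, h1, mul_zero]
  -- The function `f` is `q` read in the new chart along the i-th coordinate line through `Φ x`.
  refine ⟨U' ∩ (e.source ∩ e ⁻¹' Metric.ball (Φ x) r),
    hU'o.inter (e.isOpen_inter_preimage Metric.isOpen_ball),
    ⟨hxU', hex, Metric.mem_ball_self hr⟩, fun y hy => hy.1.1,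
    fun s => q (e.symm (Function.update (Φ x) i s)), ?_, ?_⟩
  · rintro s ⟨y, ⟨hy, hys, hyb⟩, rfl⟩
    have hb : Function.update (Φ x) i (t y) ∈ Metric.ball (Φ x) r := by
      have := update_mem_ball (Metric.mem_ball_self hr) hyb i
      simpa [hecoe, hΦ] using this
    have : ContDiffAt ℝ ∞ (fun s : ℝ => Function.update (Φ x) i s) (t y) :=
      (contDiff_update ∞ (Φ x) i).contDiffAt
    exact (ContDiffAt.comp (t y) (hQ _ hb) this).contDiffWithinAt
  · rintro y ⟨hy, hys, hyb⟩
    have hb : Function.update (Φ x) i (t y) ∈ Metric.ball (Φ x) r := by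
      have := update_mem_ball (Metric.mem_ball_self hr) hyb i
      simpa [hecoe, hΦ] using this
    have := eq_of_pd_eq_zero (fun z hz => (hQ z hz).differentiableAt (by simp)) hyb hb
      (fun j hj z hz => hQd j (fun h => hj (by subst h; simp [hecoe, hΦ])) z hz)
    beta_reduce
    rw [← this, e.left_inv hys]

/-- A smooth closed 1-form is locally exact. -/
theorem exists_potential_of_closed {α : Fin 4 → E4 → ℝ} {x : E4} {r : ℝ}
    (hα : ∀ a, SmoothOn (α a) (Metric.ball x r))
    (hcl : ∀ y ∈ Metric.ball x r, ∀ a b, pd a (α b) y = pd b (α a) y) :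
    ∃ t : E4 → ℝ, SmoothOn t (Metric.ball x r) ∧
      ∀ y ∈ Metric.ball x r, ∀ a, pd a t y = α a y := by
  have hB : IsOpen (Metric.ball x r) := Metric.isOpen_ball
  set η : E4 → E4 →L[ℝ] ℝ := fun y => ∑ a, α a y • ContinuousLinearMap.proj a with hη
  have hηs : ContDiffOn ℝ ∞ η (Metric.ball x r) :=
    ContDiffOn.sum fun a _ => ContDiffOn.smul (hα a) contDiffOn_const
  have hηe : ∀ y v, η y v = ∑ a, α a y * v a := by
    intro y v; simp [hη]
  -- Closedness of the form amounts to symmetry of the derivative of `η`, which is the hypothesis of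
  -- the Poincaré lemma on a convex set.
  have hd : ∀ y ∈ Metric.ball x r, ∀ v w, fderiv ℝ η y v w = ∑ a, ∑ b, v b * w a * pd b (α a) y := by
    intro y hy v w
    have h1 : HasFDerivAt η
        (∑ a, (fderiv ℝ (α a) y).smulRight (ContinuousLinearMap.proj (R := ℝ)
          (φ := fun _ : Fin 4 => ℝ) a)) y := by
      refine HasFDerivAt.fun_sum fun a _ => ?_
      exact ((hα a).differentiableAt hB hy).hasFDerivAt.smul_const
        (ContinuousLinearMap.proj (R := ℝ) (φ := fun _ : Fin 4 => ℝ) a)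
    rw [h1.fderiv]
    simp only [sum_apply, ContinuousLinearMap.smulRight_apply,
      smul_apply, ContinuousLinearMap.proj_apply, smul_eq_mul]
    refine Finset.sum_congr rfl fun a _ => ?_
    rw [fderiv_eq_sum_pd, Finset.sum_mul]
    exact Finset.sum_congr rfl fun b _ => by ring
  obtain ⟨t, ht⟩ :=
    (convex_ball x r).exists_forall_hasFDerivWithinAt_of_hasFDerivWithinAt_symmetric
    (dω := fderiv ℝ η)
    (fun y hy => ((hηs.contDiffAt (hB.mem_nhds hy)).differentiableAt
      (by simp)).hasFDerivAt.hasFDerivWithinAt)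
    (fun y hy v _ w _ => by
      rw [hd y hy, hd y hy, Finset.sum_comm]
      refine Finset.sum_congr rfl fun a _ => Finset.sum_congr rfl fun b _ => ?_
      rw [hcl y hy a b]; ring)
  have ht' : ∀ y ∈ Metric.ball x r, HasFDerivAt t (η y) y := fun y hy =>
    (ht y hy).hasFDerivAt (hB.mem_nhds hy)
  refine ⟨t, ?_, ?_⟩
  · refine (contDiffOn_infty_iff_fderiv_of_isOpen hB).2 ⟨fun y hy =>
      (ht' y hy).differentiableAt.differentiableWithinAt, ?_⟩
    exact hηs.congr fun y hy => (ht' y hy).fderiv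
  · intro y hy a
    simp only [pd, (ht' y hy).fderiv, hηe]
    simp [Pi.single_apply]

/-- A potential of the closed form -u serves as `t`. Its differential does not vanish and dθ is
proportional to it, so θ is locally a function of `t`. -/
theorem hasHomogeneousExpansionOn_of_closed {g : E4 → Matrix (Fin 4) (Fin 4) ℝ} {U : Set E4}
    {u : E4 → E4} (hU : IsOpen U) (hθ : SmoothOn (expansion g u) U)
    (hu : ∀ a, SmoothOn (lower g u a) U) (hu0 : ∀ x ∈ U, ∃ a, lower g u a x ≠ 0)
    (hcl : ∀ x ∈ U, ∀ a b, pd a (lower g u b) x = pd b (lower g u a) x)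
    (hpar : ∀ x ∈ U, ∃ c : ℝ, ∀ a, pd a (expansion g u) x = c * lower g u a x) :
    HasHomogeneousExpansionOn g U u := by
  intro x hx
  obtain ⟨r, hr, hball⟩ := Metric.isOpen_iff.1 hU x hx
  have hB : IsOpen (Metric.ball x r) := Metric.isOpen_ball
  obtain ⟨t, hts, ht⟩ := exists_potential_of_closed (α := fun a y => - lower g u a y) (x := x) (r := r)
    (fun a => ((hu a).mono hball).neg)
    (fun y hy a b => by rw [pd_neg, pd_neg, hcl y (hball hy)])
  obtain ⟨V, hV, hxV, hVB, f, hf, hfe⟩ := exists_eq_comp_of_pd_proportional hB hts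
    (hθ.mono hball) (Metric.mem_ball_self hr)
    (by
      obtain ⟨a, ha⟩ := hu0 x hx
      exact ⟨a, by rw [ht x (Metric.mem_ball_self hr)]; simpa using ha⟩)
    (fun y hy => by
      obtain ⟨c, hc⟩ := hpar y (hball hy)
      exact ⟨-c, fun a => by rw [hc, ht y hy]; ring⟩)
  refine ⟨V, hV, hxV, hVB.trans hball, t, f, hts.mono hVB, hf, ?_, hfe⟩
  intro y hy a
  rw [ht y (hVB hy), neg_neg]

/-! ### Metric identities and the acceleration of a unit field -/

section Lorentzian

variable {g : E4 → Matrix (Fin 4) (Fin 4) ℝ} {U : Set E4} {u : E4 → E4}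

theorem IsLorentzianOn.symm (hg : IsLorentzianOn g U) {x : E4} (hx : x ∈ U) (a b : Fin 4) :
    g x a b = g x b a := by
  obtain ⟨P, -, hP⟩ := hg.signature x hx
  have : (g x).transpose = g x := by
    rw [hP]
    simp [Matrix.transpose_mul, Matrix.mul_assoc]
  exact congrFun (congrFun this b) a

theorem IsLorentzianOn.isUnit_det (hg : IsLorentzianOn g U) {x : E4} (hx : x ∈ U) :
    IsUnit (g x).det := by
  obtain ⟨P, hP, hgP⟩ := hg.signature x hx
  rw [hgP, Matrix.det_mul, Matrix.det_mul, Matrix.det_transpose, Matrix.det_diagonal]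
  refine (hP.mul ?_).mul hP
  simp [Fin.prod_univ_four]

theorem smoothOn_det {M : E4 → Matrix (Fin 4) (Fin 4) ℝ}
    (h : ∀ a b, SmoothOn (fun x => M x a b) U) : SmoothOn (fun x => (M x).det) U := by
  simp only [Matrix.det_apply]
  refine SmoothOn.sum fun σ _ => ?_
  refine ContDiffOn.const_smul _ ?_
  exact contDiffOn_prod fun i _ => h _ _

theorem IsLorentzianOn.smooth_inv (hg : IsLorentzianOn g U) (a b : Fin 4) :
    SmoothOn (fun x => (g x)⁻¹ a b) U := by
  have hdet : SmoothOn (fun x => (g x).det) U := smoothOn_det hg.smooth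
  have hadj : SmoothOn (fun x => (g x).adjugate a b) U := by
    simp only [Matrix.adjugate_apply]
    refine smoothOn_det fun c d => ?_
    by_cases h : c = b
    · subst h; simpa using smoothOn_const _ U
    · simpa [Matrix.updateRow_ne h] using hg.smooth c d
  refine (hadj.div hdet fun x hx => (hg.isUnit_det hx).ne_zero).congr fun x hx => ?_
  simp [Matrix.inv_def]
  ring

theorem IsLorentzianOn.smooth_christoffel (hg : IsLorentzianOn g U) (a b c : Fin 4) :
    SmoothOn (christoffel g a b c) U := by
  refine (smoothOn_const _ U).mul (SmoothOn.sum fun d _ => (hg.smooth_inv a d).mul ?_)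
  exact (((hg.smooth d c).pd hg.isOpen b).add ((hg.smooth d b).pd hg.isOpen c)).sub
    ((hg.smooth b c).pd hg.isOpen d)

theorem IsLorentzianOn.christoffel_symm (hg : IsLorentzianOn g U) {x : E4} (hx : x ∈ U)
    (a b c : Fin 4) : christoffel g a b c x = christoffel g a c b x := by
  simp only [christoffel]
  congr 1
  refine Finset.sum_congr rfl fun d _ => ?_
  rw [pd_congr_on hg.isOpen (fun y hy => hg.symm hy b c) hx d]
  ring

/-- Lowering the upper index cancels the inverse metric, so that the acceleration can be handled
without inverse matrices. -/
theorem IsLorentzianOn.sum_mul_christoffel (hg : IsLorentzianOn g U) {x : E4} (hx : x ∈ U)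
    (e b c : Fin 4) : ∑ a, g x e a * christoffel g a b c x = (1 / 2) *
      (pd b (fun y => g y e c) x + pd c (fun y => g y e b) x - pd e (fun y => g y b c) x) := by
  have h1 : g x * (g x)⁻¹ = 1 := Matrix.mul_nonsing_inv _ (hg.isUnit_det hx)
  have h2 : ∀ d, ∑ a, g x e a * (g x)⁻¹ a d = if e = d then 1 else 0 := by
    intro d
    have := congrFun (congrFun h1 e) d
    rwa [Matrix.mul_apply, Matrix.one_apply] at this
  set K : Fin 4 → ℝ := fun d =>
    pd b (fun y => g y d c) x + pd c (fun y => g y d b) x - pd d (fun y => g y b c) x with hK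
  calc ∑ a, g x e a * christoffel g a b c x
      = ∑ a, ∑ d, (1 / 2) * (g x e a * (g x)⁻¹ a d * K d) := by
        refine Finset.sum_congr rfl fun a _ => ?_
        simp only [christoffel, hK, Finset.mul_sum]
        exact Finset.sum_congr rfl fun d _ => by ring
    _ = ∑ d, (1 / 2) * ((∑ a, g x e a * (g x)⁻¹ a d) * K d) := by
        rw [Finset.sum_comm]
        refine Finset.sum_congr rfl fun d _ => ?_
        rw [Finset.sum_mul, Finset.mul_sum]
    _ = (1 / 2) * K e := by
        simp only [h2]
        simp

theorem IsLorentzianOn.smooth_lower (hg : IsLorentzianOn g U) (hu : IsUnitTimelikeOn g U u)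
    (a : Fin 4) : SmoothOn (lower g u a) U :=
  SmoothOn.sum fun b _ => (hg.smooth a b).mul (hu.smooth b)

theorem IsLorentzianOn.smooth_expansion (hg : IsLorentzianOn g U) (hu : IsUnitTimelikeOn g U u) :
    SmoothOn (expansion g u) U :=
  SmoothOn.sum fun a _ => ((hu.smooth a).pd hg.isOpen a).add
    (SmoothOn.sum fun c _ => (hg.smooth_christoffel a a c).mul (hu.smooth c))

theorem sum_mul_lower (hu : IsUnitTimelikeOn g U u) {x : E4} (hx : x ∈ U) :
    ∑ a, u x a * lower g u a x = -1 := by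
  rw [← hu.unit x hx]
  simp only [lower, Finset.mul_sum]
  exact Finset.sum_congr rfl fun a _ => Finset.sum_congr rfl fun b _ => by ring

theorem exists_lower_ne_zero (hu : IsUnitTimelikeOn g U u) {x : E4} (hx : x ∈ U) :
    ∃ a, lower g u a x ≠ 0 := by
  by_contra! h
  have := sum_mul_lower hu hx
  simp [h] at this

/-- Lowered acceleration of a unit field as the contraction of `u` with its exterior derivative. -/
theorem lower_accel (hg : IsLorentzianOn g U) (hu : IsUnitTimelikeOn g U u) {x : E4} (hx : x ∈ U)
    (b : Fin 4) : lower g (accel g u) b x =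
      ∑ a, u x a * (pd a (lower g u b) x - pd b (lower g u a) x) := by
  have hU := hg.isOpen
  have dg : ∀ a b, DifferentiableAt ℝ (fun y => g y a b) x := fun a b =>
    (hg.smooth a b).differentiableAt hU hx
  have du : ∀ a, DifferentiableAt ℝ (fun y => u y a) x := fun a =>
    (hu.smooth a).differentiableAt hU hx
  have hsum : ∀ (c : Fin 4) (F : Fin 4 → E4 → ℝ), (∀ a, DifferentiableAt ℝ (F a) x) →
      pd c (fun y => ∑ a, F a y) x = ∑ a, pd c (F a) x := by
    intro c F hF
    simp only [pd]
    rw [fderiv_fun_sum fun a _ => hF a, sum_apply]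
  have hlow : ∀ a b, pd a (lower g u b) x =
      ∑ c, (pd a (fun y => g y b c) x * u x c + g x b c * pd a (fun y => u y c) x) := by
    intro a b
    have := hsum a (fun c y => g y b c * u y c) fun c => (dg b c).mul (du c)
    refine this.trans (Finset.sum_congr rfl fun c _ => pd_mul (dg b c) (du c) a)
  -- The derivative of the normalisation u^a u_a = -1. It turns u^a ∂_b u_a into (1/2) u^a u^c ∂_b
  -- g_{ac}, the term left by the Christoffel symbols.
  have hunit : ∑ a, (pd b (fun y => u y a) x * lower g u a x +
      u x a * pd b (lower g u a) x) = 0 := by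
    have dl : ∀ a, DifferentiableAt ℝ (lower g u a) x := fun a =>
      (hg.smooth_lower hu a).differentiableAt hU hx
    have := hsum b (fun a y => u y a * lower g u a y) fun a => (du a).mul (dl a)
    rw [pd_congr_on hU (fun y hy => sum_mul_lower hu hy) hx b, pd_const] at this
    rw [this]
    exact Finset.sum_congr rfl fun a _ => (pd_mul (du a) (dl a) b).symm
  have hL : lower g (accel g u) b x = ∑ a, ∑ d, u x a * (g x b d * pd a (fun y => u y d) x)
      + ∑ a, ∑ c, u x a * u x c * ∑ d, g x b d * christoffel g d a c x := by
    simp only [lower, accel, nablaUp, Fin.sum_univ_four]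
    ring
  rw [hL]
  simp only [hg.sum_mul_christoffel hx]
  have hs : ∀ a c, g x a c = g x c a := hg.symm hx
  have hds : ∀ e a c, pd e (fun y => g y a c) x = pd e (fun y => g y c a) x := fun e a c =>
    pd_congr_on hU (fun y hy => hg.symm hy a c) hx e
  simp only [hlow, lower] at hunit ⊢
  simp only [Fin.sum_univ_four] at hunit ⊢
  rw [hs 1 0, hs 2 0, hs 3 0, hs 2 1, hs 3 1, hs 3 2] at *
  rw [hds b 1 0, hds b 2 0, hds b 3 0, hds b 2 1, hds b 3 1, hds b 3 2] at *
  linear_combination (1 / 2) * hunit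

end Lorentzian

/-! ### Ideal gases in geodesic motion -/

section Kinematics

variable {g : E4 → Matrix (Fin 4) (Fin 4) ℝ} {U : Set E4} {u : E4 → E4}

/-- In geodesic motion, the pressure `p` of a classical ideal gas satisfies
`d log p = γ θ u` with `γ = 1 + kt / cv`. -/
theorem IsCIGFlow.exists_log_pressure {kt cv : ℝ} (hU : IsOpen U) (hkt : 0 < kt) (hcv : 0 < cv)
    (hgeo : IsGeodesicOn g U u) (h : IsCIGFlow kt cv g U u) :
    ∃ P : E4 → ℝ, SmoothOn P U ∧ ∀ x ∈ U, ∀ a,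
      pd a P x = (1 + kt / cv) * expansion g u x * lower g u a x := by
  obtain ⟨ρ, p, hpe, n, ε, s, Θ, hth, hp, hε⟩ := h
  have hp0 : ∀ x ∈ U, 0 < p x := fun x hx => by
    rw [hp x hx]; exact mul_pos (mul_pos hkt (hth.n_pos x hx)) (hth.Θ_pos x hx)
  refine ⟨fun x => Real.log (p x), hpe.smooth_p.log fun x hx => (hp0 x hx).ne', fun x hx a => ?_⟩
  have dn := hth.smooth_n.differentiableAt hU hx
  have dp := hpe.smooth_p.differentiableAt hU hx
  have hρ : ∀ y ∈ U, ρ y = n y + cv / kt * p y := by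
    intro y hy
    rw [hth.decomposition y hy, hε y hy, hp y hy]
    field_simp
  have hdρ : along u ρ x = along u n x + cv / kt * along u p x := by
    simp only [along, Finset.mul_sum, ← Finset.sum_add_distrib]
    refine Finset.sum_congr rfl fun b _ => ?_
    rw [pd_congr_on hU hρ hx b, pd_add dn (dp.const_mul _), pd_const_mul dp]
    ring
  -- Once `n` is removed by matter conservation, the energy equation reads (cv/kt) u(p) + (1 +
  -- cv/kt) p θ = 0.
  have hup : along u p x = -((1 + kt / cv) * p x * expansion g u x) := by
    have h1 := hpe.energy x hx
    have h2 := hth.matter x hx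
    rw [hdρ, hρ x hx] at h1
    field_simp at h1 ⊢
    linear_combination h1 - kt * h2
  have hm := hpe.momentum x hx a
  have ha : lower g (accel g u) a x = 0 := by simp [lower, hgeo x hx]
  rw [ha, hup] at hm
  rw [pd_log dp (hp0 x hx).ne', div_eq_iff (hp0 x hx).ne']
  linear_combination hm

/-- If `θ u` is closed and `u` is a unit geodesic field with nonvanishing `θ`, then `u` is closed
and `dθ` is collinear with `u`. -/
theorem closed_of_geodesic_of_expansion_mul_closed (hg : IsLorentzianOn g U)
    (hu : IsUnitTimelikeOn g U u) (hgeo : IsGeodesicOn g U u) {x : E4} (hx : x ∈ U)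
    (hθ : expansion g u x ≠ 0)
    (hcl : ∀ a b, pd a (fun y => expansion g u y * lower g u b y) x =
      pd b (fun y => expansion g u y * lower g u a y) x) :
    (∀ a b, pd a (lower g u b) x = pd b (lower g u a) x) ∧
      ∀ a, pd a (expansion g u) x = -along u (expansion g u) x * lower g u a x := by
  have hU := hg.isOpen
  have dθ := (hg.smooth_expansion hu).differentiableAt hU hx
  have dl : ∀ a, DifferentiableAt ℝ (lower g u a) x := fun a =>
    (hg.smooth_lower hu a).differentiableAt hU hx
  have hcl' : ∀ a b, pd a (expansion g u) x * lower g u b x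
      + expansion g u x * pd a (lower g u b) x = pd b (expansion g u) x * lower g u a x
      + expansion g u x * pd b (lower g u a) x := by
    intro a b
    have := hcl a b
    rwa [pd_mul dθ (dl b), pd_mul dθ (dl a)] at this
  have hacc : ∀ b, ∑ a, u x a * (pd a (lower g u b) x - pd b (lower g u a) x) = 0 := by
    intro b
    rw [← lower_accel hg hu hx]
    simp [lower, hgeo x hx]
  have hunit := sum_mul_lower hu hx
  -- Contraction of dθ ∧ u + θ du = 0 with u: the geodesic equation removes the du term, and u·u =
  -- -1 isolates dθ.
  have hgrad : ∀ a, pd a (expansion g u) x = -along u (expansion g u) x * lower g u a x := by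
    intro b
    have h0 := hacc b
    have h1 : ∀ a, u x a * (pd a (expansion g u) x * lower g u b x
        + expansion g u x * pd a (lower g u b) x - (pd b (expansion g u) x * lower g u a x
        + expansion g u x * pd b (lower g u a) x)) = 0 := fun a => by rw [hcl' a b]; ring
    simp only [along, Fin.sum_univ_four] at h0 hunit ⊢
    linear_combination h1 0 + h1 1 + h1 2 + h1 3 - expansion g u x * h0
      + pd b (expansion g u) x * hunit
  refine ⟨fun a b => ?_, hgrad⟩
  -- As dθ is collinear with u, the term dθ ∧ u drops out, leaving θ du = 0.
  have := hcl' a b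
  rw [hgrad a, hgrad b] at this
  exact mul_left_cancel₀ hθ (by linear_combination this)

/-- The Christoffel terms cancel in the antisymmetrised covariant derivative, which is then half the
exterior derivative. -/
theorem isVorticityFreeOn_of_closed (hg : IsLorentzianOn g U)
    (hcl : ∀ x ∈ U, ∀ a b, pd a (lower g u b) x = pd b (lower g u a) x) :
    IsVorticityFreeOn g U u := by
  intro x hx a b
  refine Finset.sum_eq_zero fun c _ => Finset.sum_eq_zero fun d _ => ?_
  have : nablaDown g u c d x = nablaDown g u d c x := by
    simp only [nablaDown, hcl x hx c d]
    congr 1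
    exact Finset.sum_congr rfl fun e _ => by rw [hg.christoffel_symm hx e c d]
  rw [this]; ring

theorem IsCIGFlow.vorticityFree_and_homogeneous {kt cv : ℝ} (hg : IsLorentzianOn g U)
    (hu : IsUnitTimelikeOn g U u) (hgeo : IsGeodesicOn g U u)
    (hθ : ∀ x ∈ U, expansion g u x ≠ 0) (hkt : 0 < kt) (hcv : 0 < cv)
    (h : IsCIGFlow kt cv g U u) :
    IsVorticityFreeOn g U u ∧ HasHomogeneousExpansionOn g U u := by
  have hU := hg.isOpen
  obtain ⟨P, hPs, hP⟩ := h.exists_log_pressure hU hkt hcv hgeo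
  have hγ : (1 + kt / cv) ≠ 0 := by positivity
  have hpd : ∀ a, ∀ x ∈ U, expansion g u x * lower g u a x = (1 + kt / cv)⁻¹ * pd a P x := by
    intro a x hx
    rw [hP x hx]; field_simp
  have key := fun x (hx : x ∈ U) => closed_of_geodesic_of_expansion_mul_closed hg hu hgeo hx
    (hθ x hx) fun a b => by
      rw [pd_congr_on hU (hpd b) hx, pd_congr_on hU (hpd a) hx,
        pd_const_mul ((hPs.pd hU b).differentiableAt hU hx),
        pd_const_mul ((hPs.pd hU a).differentiableAt hU hx), pd_comm hPs hU hx]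
  exact ⟨isVorticityFreeOn_of_closed hg fun x hx => (key x hx).1,
    hasHomogeneousExpansionOn_of_closed hU (hg.smooth_expansion hu) (hg.smooth_lower hu)
      (fun x hx => exists_lower_ne_zero hu hx) (fun x hx => (key x hx).1)
      fun x hx => ⟨_, (key x hx).2⟩⟩

/-- A smooth function on an open interval has a smooth primitive. -/
theorem exists_smooth_primitive {f : ℝ → ℝ} {I : Set ℝ} (hI : IsOpen I) (hc : IsPreconnected I)
    (hf : ContDiffOn ℝ ∞ f I) :
    ∃ F : ℝ → ℝ, ContDiffOn ℝ ∞ F I ∧ ∀ s ∈ I, HasDerivAt F (f s) s := by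
  rcases I.eq_empty_or_nonempty with rfl | ⟨s₀, hs₀⟩
  · exact ⟨0, by simp, by simp⟩
  have hF : ∀ s ∈ I, HasDerivAt (fun z => ∫ y in s₀..z, f y) (f s) s := by
    intro s hs
    refine intervalIntegral.integral_hasDerivAt_right ?_ ?_ ?_
    · exact (hf.continuousOn.mono (hc.ordConnected.uIcc_subset hs₀ hs)).intervalIntegrable
    · exact ContinuousOn.stronglyMeasurableAtFilter hI hf.continuousOn s hs
    · exact hf.continuousOn.continuousAt (hI.mem_nhds hs)
  refine ⟨_, (contDiffOn_infty_iff_deriv_of_isOpen hI).2 ⟨fun s hs =>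
    (hF s hs).differentiableAt.differentiableWithinAt, hf.congr fun s hs => (hF s hs).deriv⟩, hF⟩

/-- A submersion is open. Together with connectedness this makes the range of `t` an open interval,
on which θ(t) has a smooth primitive. -/
theorem isOpen_image_of_pd_ne_zero {t : E4 → ℝ} (hU : IsOpen U) (ht : SmoothOn t U)
    (h0 : ∀ x ∈ U, ∃ a, pd a t x ≠ 0) : IsOpen (t '' U) := by
  rw [isOpen_iff_mem_nhds]
  rintro _ ⟨x, hx, rfl⟩
  have hs := (ht.contDiffAt hU hx).hasStrictFDerivAt (by simp)
  obtain ⟨a, ha⟩ := h0 x hx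
  have hsurj : (fderiv ℝ t x).range = ⊤ := by
    rw [LinearMap.range_eq_top]
    intro c
    refine ⟨(c / pd a t x) • Pi.single a 1, ?_⟩
    change fderiv ℝ t x _ = _
    rw [map_smul, smul_eq_mul]
    exact div_mul_cancel₀ c ha
  rw [← hs.map_nhds_eq_of_surj hsurj]
  exact Filter.image_mem_map (hU.mem_nhds hx)

/-- A geodesic flow with `u = -dt` and `θ = θ(t)` is the velocity of an isentropic classical ideal
gas. -/
theorem IsSynchronousHomogeneous.isCIGFlow {kt cv : ℝ} (hg : IsLorentzianOn g U)
    (hu : IsUnitTimelikeOn g U u) (hgeo : IsGeodesicOn g U u) (hkt : 0 < kt) (hcv : 0 < cv)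
    {t : E4 → ℝ} {f : ℝ → ℝ} (hc : IsPreconnected U)
    (h : IsSynchronousHomogeneous g U u t f) : IsCIGFlow kt cv g U u := by
  have hU := hg.isOpen
  have ht0 : ∀ x ∈ U, ∃ a, pd a t x ≠ 0 := by
    intro x hx
    obtain ⟨a, ha⟩ := exists_lower_ne_zero hu hx
    exact ⟨a, fun h' => ha (by rw [h.eq_neg_dt x hx, h', neg_zero])⟩
  obtain ⟨F, hFs, hF⟩ := exists_smooth_primitive (isOpen_image_of_pd_ne_zero hU h.smooth_t ht0)
    (hc.image t h.smooth_t.continuousOn) h.smooth_f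
  -- With T = ∫ θ dt one has dT = -θ u, hence u(T) = θ because u·u = -1, and every exp(cT) satisfies
  -- u(exp(cT)) = c θ exp(cT).
  set T : E4 → ℝ := fun x => F (t x) with hT
  have hTs : SmoothOn T U := ContDiffOn.comp hFs h.smooth_t (Set.mapsTo_image t U)
  have hTd : ∀ x ∈ U, ∀ a, pd a T x = -(expansion g u x * lower g u a x) := by
    intro x hx a
    rw [hT, pd_comp (hF _ ⟨x, hx, rfl⟩) (h.smooth_t.differentiableAt hU hx), h.eq_neg_dt x hx,
      h.expansion_eq x hx]
    ring
  set E : ℝ → E4 → ℝ := fun c x => Real.exp (c * T x) with hE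
  have hEs : ∀ c, SmoothOn (E c) U := fun c => ((smoothOn_const c U).mul hTs).exp
  have hEd : ∀ c, ∀ x ∈ U, ∀ a,
      pd a (E c) x = -(c * E c x * (expansion g u x * lower g u a x)) := by
    intro c x hx a
    have hd := hTs.differentiableAt hU hx
    rw [hE]
    simp only
    rw [pd_comp (h := Real.exp) (Real.hasDerivAt_exp _) (hd.const_mul c), pd_const_mul hd,
      hTd x hx]
    ring
  have hEpos : ∀ c x, 0 < E c x := fun c x => Real.exp_pos _
  have hEu : ∀ c, ∀ x ∈ U, along u (E c) x = c * E c x * expansion g u x := by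
    intro c x hx
    have h1 := sum_mul_lower hu hx
    simp only [along, hEd c x hx, Fin.sum_univ_four] at h1 ⊢
    linear_combination -(c * E c x * expansion g u x) * h1
  set k := kt / cv with hk
  have hkt' : kt = k * cv := by rw [hk]; field_simp
  have hEmul : ∀ x, E (-1) x * E (-k) x = E (-1 - k) x := by
    intro x; simp only [hE]; rw [← Real.exp_add]; ring_nf
  have hinv : ∀ x, 1 / E (-1) x = E 1 x := by
    intro x; simp only [hE]; rw [one_div, ← Real.exp_neg]; ring_nf
  have hEone : ∀ x, E (-1) x * E 1 x = 1 := fun x => by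
    rw [← hinv, mul_one_div_cancel (hEpos _ _).ne']
  have hd : ∀ c, ∀ x ∈ U, DifferentiableAt ℝ (E c) x := fun c x hx =>
    (hEs c).differentiableAt hU hx
  have halong : ∀ (a b : ℝ) (c d : ℝ), ∀ x ∈ U, along u (fun y => a * E c y + b * E d y) x
      = a * along u (E c) x + b * along u (E d) x := by
    intro a b c d x hx
    simp only [along, Finset.mul_sum, ← Finset.sum_add_distrib]
    refine Finset.sum_congr rfl fun i _ => ?_
    rw [pd_add ((hd c x hx).const_mul a) ((hd d x hx).const_mul b), pd_const_mul (hd c x hx),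
      pd_const_mul (hd d x hx)]
    ring
  -- Matter conservation suggests n = exp(-T). With constant entropy the first law is met by Θ =
  -- exp(-(kt/cv) T), whence p = kt nΘ and ρ = n + cv nΘ. The coefficients 1 and 0 give both fields
  -- the shape expected by `halong`.
  refine ⟨fun x => 1 * E (-1) x + cv * E (-1 - k) x,
    fun x => 0 * E (-1) x + kt * E (-1 - k) x,
    ⟨?_, ?_, ?_, ?_⟩, E (-1), fun x => cv * E (-k) x, fun _ => 0, E (-k),
    ⟨hEs _, (smoothOn_const cv U).mul (hEs _), smoothOn_const 0 U, hEs _, fun x _ => hEpos _ x,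
      ?_, fun x _ => hEpos _ x, ?_, ?_, ?_⟩, ?_, fun x _ => rfl⟩
  · exact ((smoothOn_const 1 U).mul (hEs _)).add ((smoothOn_const cv U).mul (hEs _))
  · exact ((smoothOn_const 0 U).mul (hEs _)).add ((smoothOn_const kt U).mul (hEs _))
  · intro x hx a
    have ha : lower g (accel g u) a x = 0 := by simp [lower, hgeo x hx]
    rw [ha, halong _ _ _ _ x hx, pd_add ((hd _ x hx).const_mul _) ((hd _ x hx).const_mul _),
      pd_const_mul (hd _ x hx), pd_const_mul (hd _ x hx), hEd _ x hx, hEd _ x hx, hEu _ x hx,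
      hEu _ x hx]
    ring
  · intro x hx
    rw [halong _ _ _ _ x hx, hEu _ x hx, hEu _ x hx, hkt']
    ring
  · intro x hx
    have := mul_pos hcv (hEpos (-1 - k) x)
    linarith
  · intro x hx
    rw [hEu _ x hx]; ring
  · intro x hx
    rw [← hEmul]; ring
  · intro x hx a
    simp only [hinv, pd_const, hEd _ x hx, pd_const_mul (hd _ x hx), ← hEmul]
    rw [hkt']
    linear_combination (k * cv * E (-k) x * expansion g u x * lower g u a x) * hEone x
  · intro x hx
    linear_combination -kt * hEmul x

end Kinematics

/-! ### Curvature and Einstein equations of the T-metric -/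

noncomputable section

/-- The conformal factor of the two-dimensional space of constant curvature `k`. -/
def confFactor (k : ℝ) (x : E4) : ℝ := (1 + k / 4 * (x 2 ^ 2 + x 3 ^ 2))⁻¹

/-- The metric `-dt²/V + Ω² dr² + Φ C² (dx² + dy²)` for scalar fields `V`, `Φ`, `Ω`. -/
def fieldMetric (k : ℝ) (V Φ Ω : E4 → ℝ) (x : E4) : Matrix (Fin 4) (Fin 4) ℝ :=
  Matrix.diagonal ![-(1 / V x), Ω x ^ 2, Φ x * confFactor k x ^ 2, Φ x * confFactor k x ^ 2]

/-- Smooth fields `V(t)`, `Φ(t)` and `Ω(t, r)` defining a nondegenerate `fieldMetric`. -/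
structure IsTFields (k : ℝ) (V Φ Ω : E4 → ℝ) (U : Set E4) : Prop where
  isOpen : IsOpen U
  C_ne : ∀ x ∈ U, 1 + k / 4 * (x 2 ^ 2 + x 3 ^ 2) ≠ 0
  V_pos : ∀ x ∈ U, 0 < V x
  Φ_pos : ∀ x ∈ U, 0 < Φ x
  Ω_ne : ∀ x ∈ U, Ω x ≠ 0
  smooth_V : SmoothOn V U
  smooth_Φ : SmoothOn Φ U
  smooth_Ω : SmoothOn Ω U
  pd_V : ∀ x ∈ U, ∀ i, i ≠ 0 → pd i V x = 0
  pd_Φ : ∀ x ∈ U, ∀ i, i ≠ 0 → pd i Φ x = 0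
  pd_Ω : ∀ x ∈ U, ∀ i, i ≠ 0 → i ≠ 1 → pd i Ω x = 0

/-- Logarithmic derivative of `f` along the `i`-th coordinate. -/
def logPd (i : Fin 4) (f : E4 → ℝ) (x : E4) : ℝ := pd i f x / f x

/-- Half of the logarithmic time derivative. -/
def halfLogPd (f : E4 → ℝ) (x : E4) : ℝ := pd 0 f x / (2 * f x)

/-- Logarithmic derivative of `confFactor`. -/
def logPdConf (k : ℝ) (i : Fin 4) (x : E4) : ℝ := -(k / 2) * (x i * confFactor k x)

/-- The Christoffel symbols of `fieldMetric`. -/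
def tChristoffel (k : ℝ) (V Φ Ω : E4 → ℝ) (a b c : Fin 4) : E4 → ℝ :=
  match a with
  | 0 => (Matrix.diagonal ![fun x => -(1 / 2) * logPd 0 V x,
      fun x => V x * Ω x ^ 2 * logPd 0 Ω x,
      fun x => V x * (Φ x * confFactor k x ^ 2) * halfLogPd Φ x,
      fun x => V x * (Φ x * confFactor k x ^ 2) * halfLogPd Φ x] :
      Matrix (Fin 4) (Fin 4) (E4 → ℝ)) b c
  | 1 => !![0, logPd 0 Ω, 0, 0; logPd 0 Ω, logPd 1 Ω, 0, 0; 0, 0, 0, 0; 0, 0, 0, 0] b c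
  | 2 => !![0, 0, halfLogPd Φ, 0; 0, 0, 0, 0; halfLogPd Φ, 0, logPdConf k 2, logPdConf k 3;
      0, 0, logPdConf k 3, fun x => -logPdConf k 2 x] b c
  | 3 => !![0, 0, 0, halfLogPd Φ; 0, 0, 0, 0; 0, 0, fun x => -logPdConf k 3 x, logPdConf k 2;
      halfLogPd Φ, 0, logPdConf k 2, logPdConf k 3] b c

/-- Partial derivatives `∂_b g_{aa}` of the diagonal components of `fieldMetric`. -/
def tMetricPd (k : ℝ) (V Φ Ω : E4 → ℝ) (x : E4) : Matrix (Fin 4) (Fin 4) ℝ :=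
  !![logPd 0 V x / V x, 0, 0, 0;
    2 * Ω x ^ 2 * logPd 0 Ω x, 2 * Ω x ^ 2 * logPd 1 Ω x, 0, 0;
    2 * (Φ x * confFactor k x ^ 2) * halfLogPd Φ x, 0,
      2 * (Φ x * confFactor k x ^ 2) * logPdConf k 2 x,
      2 * (Φ x * confFactor k x ^ 2) * logPdConf k 3 x;
    2 * (Φ x * confFactor k x ^ 2) * halfLogPd Φ x, 0,
      2 * (Φ x * confFactor k x ^ 2) * logPdConf k 2 x,
      2 * (Φ x * confFactor k x ^ 2) * logPdConf k 3 x]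

end

namespace IsTFields

variable {k : ℝ} {V Φ Ω : E4 → ℝ} {U : Set E4}

theorem conf_ne (h : IsTFields k V Φ Ω U) {x : E4} (hx : x ∈ U) : confFactor k x ≠ 0 :=
  inv_ne_zero (h.C_ne x hx)

theorem differentiableAt_conf (h : IsTFields k V Φ Ω U) {x : E4} (hx : x ∈ U) :
    DifferentiableAt ℝ (confFactor k) x := by
  unfold confFactor
  exact DifferentiableAt.fun_inv (by fun_prop) (h.C_ne x hx)

theorem pd_conf (h : IsTFields k V Φ Ω U) {x : E4} (hx : x ∈ U) (i : Fin 4) :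
    pd i (confFactor k) x =
      if i = 2 ∨ i = 3 then confFactor k x * logPdConf k i x else 0 := by
  have h2 : DifferentiableAt ℝ (fun y : E4 => y 2) x := by fun_prop
  have h3 : DifferentiableAt ℝ (fun y : E4 => y 3) x := by fun_prop
  have : pd i (confFactor k) x = -(k / 4 * (2 * x 2 * pd i (fun y => y 2) x
      + 2 * x 3 * pd i (fun y => y 3) x)) / (1 + k / 4 * (x 2 ^ 2 + x 3 ^ 2)) ^ 2 := by
    unfold confFactor
    rw [pd_inv (by fun_prop) (h.C_ne x hx), pd_add (by fun_prop) (by fun_prop), pd_const,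
      pd_const_mul (by fun_prop), pd_add (by fun_prop) (by fun_prop), pd_sq h2, pd_sq h3]
    ring
  rw [this, pd_coord, pd_coord]
  have hC := h.C_ne x hx
  fin_cases i <;> simp [logPdConf, confFactor] <;> field_simp <;> ring

theorem inv_fieldMetric (h : IsTFields k V Φ Ω U) {x : E4} (hx : x ∈ U) :
    (fieldMetric k V Φ Ω x)⁻¹ = Matrix.diagonal ![-V x, (Ω x ^ 2)⁻¹,
      (Φ x * confFactor k x ^ 2)⁻¹, (Φ x * confFactor k x ^ 2)⁻¹] := by
  apply Matrix.inv_eq_right_inv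
  have hV := (h.V_pos x hx).ne'
  have hΦ := (h.Φ_pos x hx).ne'
  have hΩ := h.Ω_ne x hx
  have hC := h.conf_ne hx
  rw [fieldMetric, Matrix.diagonal_mul_diagonal, ← Matrix.diagonal_one]
  congr 1
  funext i
  fin_cases i <;> simp <;> field_simp

theorem pd_fieldMetric (h : IsTFields k V Φ Ω U) {x : E4} (hx : x ∈ U) (b c d : Fin 4) :
    pd b (fun y => fieldMetric k V Φ Ω y d c) x =
      if d = c then tMetricPd k V Φ Ω x d b else 0 := by
  by_cases hdc : d = c
  swap
  · simp [fieldMetric, hdc]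
  subst hdc
  have hU := h.isOpen
  have hV := (h.V_pos x hx).ne'
  have hΦ := (h.Φ_pos x hx).ne'
  have hΩ := h.Ω_ne x hx
  have dV := h.smooth_V.differentiableAt hU hx
  have dΦ := h.smooth_Φ.differentiableAt hU hx
  have dΩ := h.smooth_Ω.differentiableAt hU hx
  have dC := h.differentiableAt_conf hx
  have e0 : pd b (fun y => -(V y)⁻¹) x = pd b V x / V x ^ 2 := by
    rw [pd_neg, pd_inv dV hV]; ring
  have e2 : pd b (fun y => Φ y * confFactor k y ^ 2) x = pd b Φ x * confFactor k x ^ 2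
      + Φ x * (2 * confFactor k x * pd b (confFactor k) x) := by
    rw [pd_mul dΦ (dC.fun_pow 2), pd_sq dC]
  have pV := h.pd_V x hx b
  have pΦ := h.pd_Φ x hx b
  have pΩ := h.pd_Ω x hx b
  have pC := h.pd_conf hx b
  fin_cases d <;> simp [fieldMetric, e0, e2, pd_sq dΩ, tMetricPd] <;> fin_cases b <;>
    simp_all [logPd, halfLogPd] <;> field_simp

set_option maxHeartbeats 1000000 in
theorem christoffel_eq (h : IsTFields k V Φ Ω U) {x : E4} (hx : x ∈ U) (a b c : Fin 4) :
    christoffel (fieldMetric k V Φ Ω) a b c x = tChristoffel k V Φ Ω a b c x := by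
  have hV := (h.V_pos x hx).ne'
  have hΦ := (h.Φ_pos x hx).ne'
  have hΩ := h.Ω_ne x hx
  have hC := h.conf_ne hx
  simp only [christoffel, h.inv_fieldMetric hx, h.pd_fieldMetric hx]
  rw [Finset.sum_eq_single a (fun d _ hd => by simp [Ne.symm hd]) (by simp)]
  rw [Matrix.diagonal_apply_eq]
  fin_cases a <;> fin_cases b <;> fin_cases c <;>
    simp [tChristoffel, tMetricPd] <;> field_simp

end IsTFields

theorem pd_zero_fun (i : Fin 4) (x : E4) : pd i (0 : E4 → ℝ) x = 0 := pd_const 0 i x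

namespace IsTFields

variable {k : ℝ} {V Φ Ω : E4 → ℝ} {U : Set E4}

theorem smooth_logPd_Ω (h : IsTFields k V Φ Ω U) (i : Fin 4) : SmoothOn (logPd i Ω) U :=
  (h.smooth_Ω.pd h.isOpen i).div h.smooth_Ω h.Ω_ne

theorem smooth_halfLogPd_Φ (h : IsTFields k V Φ Ω U) : SmoothOn (halfLogPd Φ) U :=
  (h.smooth_Φ.pd h.isOpen 0).div ((smoothOn_const 2 U).mul h.smooth_Φ)
    fun x hx => mul_ne_zero two_ne_zero (h.Φ_pos x hx).ne'

theorem pd_logPd_Ω (h : IsTFields k V Φ Ω U) {x : E4} (hx : x ∈ U) {i : Fin 4} (h0 : i ≠ 0)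
    (h1 : i ≠ 1) : pd i (logPd 0 Ω) x = 0 := by
  have hU := h.isOpen
  unfold logPd
  rw [pd_div ((h.smooth_Ω.pd hU 0).differentiableAt hU hx) (h.smooth_Ω.differentiableAt hU hx)
    (h.Ω_ne x hx), pd_comm h.smooth_Ω hU hx,
    pd_congr_on hU (fun y hy => h.pd_Ω y hy i h0 h1) hx, pd_const, h.pd_Ω x hx i h0 h1]
  simp

theorem pd_halfLogPd_Φ (h : IsTFields k V Φ Ω U) {x : E4} (hx : x ∈ U) {i : Fin 4} (h0 : i ≠ 0) :
    pd i (halfLogPd Φ) x = 0 := by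
  have hU := h.isOpen
  have dΦ := h.smooth_Φ.differentiableAt hU hx
  unfold halfLogPd
  rw [pd_div ((h.smooth_Φ.pd hU 0).differentiableAt hU hx) (dΦ.const_mul 2)
    (mul_ne_zero two_ne_zero (h.Φ_pos x hx).ne'), pd_comm h.smooth_Φ hU hx,
    pd_congr_on hU (fun y hy => h.pd_Φ y hy i h0) hx, pd_const, pd_const_mul dΦ,
    h.pd_Φ x hx i h0]
  simp

theorem pd_zero_V (h : IsTFields k V Φ Ω U) {x : E4} (hx : x ∈ U) :
    pd 0 V x = V x * logPd 0 V x := by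
  have := (h.V_pos x hx).ne'
  unfold logPd; field_simp

theorem pd_zero_Φ (h : IsTFields k V Φ Ω U) {x : E4} (hx : x ∈ U) :
    pd 0 Φ x = 2 * Φ x * halfLogPd Φ x := by
  have := (h.Φ_pos x hx).ne'
  unfold halfLogPd; field_simp

theorem pd_zero_Ω (h : IsTFields k V Φ Ω U) {x : E4} (hx : x ∈ U) :
    pd 0 Ω x = Ω x * logPd 0 Ω x := by
  have := h.Ω_ne x hx
  unfold logPd; field_simp

theorem pd_logPdConf (h : IsTFields k V Φ Ω U) {x : E4} (hx : x ∈ U) {i : Fin 4}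
    (hi : i = 2 ∨ i = 3) : pd i (logPdConf k i) x =
      -(k / 2) * (confFactor k x + x i * (confFactor k x * logPdConf k i x)) := by
  have hd : DifferentiableAt ℝ (fun y : E4 => y i) x := by fun_prop
  have hc := h.differentiableAt_conf hx
  have : logPdConf k i = fun y => -(k / 2) * (y i * confFactor k y) := rfl
  rw [this, pd_const_mul (hd.fun_mul hc), pd_mul hd hc, pd_coord, h.pd_conf hx, if_pos rfl, if_pos hi]
  simp [logPdConf]

theorem ricci_eq (h : IsTFields k V Φ Ω U) {x : E4} (hx : x ∈ U) (b c : Fin 4) :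
    ricci (fieldMetric k V Φ Ω) b c x =
      ∑ a, (pd a (tChristoffel k V Φ Ω a b c) x - pd c (tChristoffel k V Φ Ω a b a) x +
        ∑ d, (tChristoffel k V Φ Ω a a d x * tChristoffel k V Φ Ω d b c x -
          tChristoffel k V Φ Ω a c d x * tChristoffel k V Φ Ω d b a x)) := by
  simp only [ricci, h.christoffel_eq hx]
  refine Finset.sum_congr rfl fun a _ => ?_
  rw [pd_congr_on h.isOpen (fun y hy => h.christoffel_eq hy a b c) hx,
    pd_congr_on h.isOpen (fun y hy => h.christoffel_eq hy a b a) hx]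

theorem pd_zero_christoffel_one (h : IsTFields k V Φ Ω U) {x : E4} (hx : x ∈ U) :
    pd 0 (fun y => V y * Ω y ^ 2 * logPd 0 Ω y) x = V x * Ω x ^ 2 *
      (logPd 0 V x * logPd 0 Ω x + 2 * logPd 0 Ω x ^ 2 + pd 0 (logPd 0 Ω) x) := by
  have hU := h.isOpen
  have dV := h.smooth_V.differentiableAt hU hx
  have dΩ := h.smooth_Ω.differentiableAt hU hx
  rw [pd_mul (dV.fun_mul (dΩ.fun_pow 2)) ((h.smooth_logPd_Ω 0).differentiableAt hU hx),
    pd_mul dV (dΩ.fun_pow 2), pd_sq dΩ, h.pd_zero_V hx, h.pd_zero_Ω hx]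
  ring

theorem pd_zero_christoffel_two (h : IsTFields k V Φ Ω U) {x : E4} (hx : x ∈ U) :
    pd 0 (fun y => V y * (Φ y * confFactor k y ^ 2) * halfLogPd Φ y) x =
      V x * (Φ x * confFactor k x ^ 2) *
      (logPd 0 V x * halfLogPd Φ x + 2 * halfLogPd Φ x ^ 2 + pd 0 (halfLogPd Φ) x) := by
  have hU := h.isOpen
  have dV := h.smooth_V.differentiableAt hU hx
  have dΦ := h.smooth_Φ.differentiableAt hU hx
  have dC := h.differentiableAt_conf hx
  rw [pd_mul (dV.fun_mul (dΦ.fun_mul (dC.fun_pow 2))) (h.smooth_halfLogPd_Φ.differentiableAt hU hx),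
    pd_mul dV (dΦ.fun_mul (dC.fun_pow 2)), pd_mul dΦ (dC.fun_pow 2), pd_sq dC, h.pd_zero_V hx,
    h.pd_zero_Φ hx, h.pd_conf hx]
  simp
  ring

theorem ricci_zero_zero (h : IsTFields k V Φ Ω U) {x : E4} (hx : x ∈ U) :
    ricci (fieldMetric k V Φ Ω) 0 0 x =
      -(pd 0 (logPd 0 Ω) x + 2 * pd 0 (halfLogPd Φ) x) - (logPd 0 Ω x ^ 2 + 2 * halfLogPd Φ x ^ 2)
        - logPd 0 V x / 2 * (logPd 0 Ω x + 2 * halfLogPd Φ x) := by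
  rw [h.ricci_eq hx]
  simp [Fin.sum_univ_four, tChristoffel, pd_zero_fun]
  ring

theorem ricci_one_one (h : IsTFields k V Φ Ω U) {x : E4} (hx : x ∈ U) :
    ricci (fieldMetric k V Φ Ω) 1 1 x = Ω x ^ 2 * (V x * (pd 0 (logPd 0 Ω) x
      + logPd 0 V x * logPd 0 Ω x / 2 + logPd 0 Ω x * (logPd 0 Ω x + 2 * halfLogPd Φ x))) := by
  rw [h.ricci_eq hx]
  simp [Fin.sum_univ_four, tChristoffel, pd_zero_fun, h.pd_zero_christoffel_one hx]
  ring

/-- The Liouville equation Δ log C = -k C²: the surfaces with metric C²(dx² + dy²) have Gauss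
curvature k. It is the source of the k terms in the Ricci tensor. -/
theorem pd_logPdConf_add (h : IsTFields k V Φ Ω U) {x : E4} (hx : x ∈ U) :
    pd 2 (logPdConf k 2) x + pd 3 (logPdConf k 3) x = -(k * confFactor k x ^ 2) := by
  have hC : confFactor k x * (1 + k / 4 * (x 2 ^ 2 + x 3 ^ 2)) = 1 :=
    inv_mul_cancel₀ (h.C_ne x hx)
  rw [h.pd_logPdConf hx (Or.inl rfl), h.pd_logPdConf hx (Or.inr rfl)]
  unfold logPdConf
  linear_combination (-(k * confFactor k x)) * hC * (1 - 2)

theorem ricci_two_two (h : IsTFields k V Φ Ω U) {x : E4} (hx : x ∈ U) :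
    ricci (fieldMetric k V Φ Ω) 2 2 x = Φ x * confFactor k x ^ 2 * (V x * (pd 0 (halfLogPd Φ) x
      + logPd 0 V x * halfLogPd Φ x / 2 + halfLogPd Φ x * (logPd 0 Ω x + 2 * halfLogPd Φ x)))
      + k * confFactor k x ^ 2 := by
  rw [h.ricci_eq hx]
  simp [Fin.sum_univ_four, tChristoffel, pd_zero_fun, h.pd_zero_christoffel_two hx, pd_neg]
  linear_combination -h.pd_logPdConf_add hx

theorem ricci_three_three (h : IsTFields k V Φ Ω U) {x : E4} (hx : x ∈ U) :
    ricci (fieldMetric k V Φ Ω) 3 3 x = Φ x * confFactor k x ^ 2 * (V x * (pd 0 (halfLogPd Φ) x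
      + logPd 0 V x * halfLogPd Φ x / 2 + halfLogPd Φ x * (logPd 0 Ω x + 2 * halfLogPd Φ x)))
      + k * confFactor k x ^ 2 := by
  rw [h.ricci_eq hx]
  simp [Fin.sum_univ_four, tChristoffel, pd_zero_fun, h.pd_zero_christoffel_two hx, pd_neg]
  linear_combination -h.pd_logPdConf_add hx

theorem scalarCurv_eq (h : IsTFields k V Φ Ω U) {x : E4} (hx : x ∈ U) :
    scalarCurv (fieldMetric k V Φ Ω) x = V x * (2 * pd 0 (logPd 0 Ω) x
      + 4 * pd 0 (halfLogPd Φ) x + logPd 0 V x * (logPd 0 Ω x + 2 * halfLogPd Φ x)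
      + 2 * logPd 0 Ω x ^ 2 + 4 * logPd 0 Ω x * halfLogPd Φ x + 6 * halfLogPd Φ x ^ 2)
      + 2 * k / Φ x := by
  have hΦ := (h.Φ_pos x hx).ne'
  have hΩ := h.Ω_ne x hx
  have hC := h.conf_ne hx
  simp only [scalarCurv, h.inv_fieldMetric hx, Fin.sum_univ_four]
  simp [h.ricci_zero_zero hx, h.ricci_one_one hx, h.ricci_two_two hx, h.ricci_three_three hx]
  field_simp
  ring

theorem lower_eq (h : IsTFields k V Φ Ω U) {x : E4} (hx : x ∈ U) {u : E4 → E4}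
    (hu : u x = Pi.single 0 (Real.sqrt (V x))) (a : Fin 4) :
    lower (fieldMetric k V Φ Ω) u a x = if a = 0 then -(1 / Real.sqrt (V x)) else 0 := by
  have hV := Real.mul_self_sqrt (h.V_pos x hx).le
  have hs := (Real.sqrt_pos.2 (h.V_pos x hx)).ne'
  have hV' := (h.V_pos x hx).ne'
  simp only [lower, hu, Fin.sum_univ_four, fieldMetric]
  fin_cases a <;> simp
  field_simp
  linear_combination hV

theorem expansion_eq (h : IsTFields k V Φ Ω U) {x : E4} (hx : x ∈ U) {u : E4 → E4}
    (hu : ∀ y, u y = Pi.single 0 (Real.sqrt (V y))) :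
    expansion (fieldMetric k V Φ Ω) u x =
      Real.sqrt (V x) * (logPd 0 Ω x + 2 * halfLogPd Φ x) := by
  have hs := (Real.sqrt_pos.2 (h.V_pos x hx)).ne'
  have hV := Real.mul_self_sqrt (h.V_pos x hx).le
  have dV := h.smooth_V.differentiableAt h.isOpen hx
  simp only [expansion, nablaUp, h.christoffel_eq hx, hu, Fin.sum_univ_four]
  simp [tChristoffel, pd_sqrt dV (h.V_pos x hx), h.pd_zero_V hx]
  field_simp
  linear_combination (-logPd 0 V x) * hV

/-- The derivative of √V along time cancels against Γ^0_{00} = -V'/(2V), since V depends on time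
alone. -/
theorem accel_eq_zero (h : IsTFields k V Φ Ω U) {x : E4} (hx : x ∈ U) {u : E4 → E4}
    (hu : ∀ y, u y = Pi.single 0 (Real.sqrt (V y))) :
    accel (fieldMetric k V Φ Ω) u x = 0 := by
  have hs := (Real.sqrt_pos.2 (h.V_pos x hx)).ne'
  have hV := Real.mul_self_sqrt (h.V_pos x hx).le
  have dV := h.smooth_V.differentiableAt h.isOpen hx
  funext b
  simp only [accel, nablaUp, h.christoffel_eq hx, hu, Fin.sum_univ_four]
  fin_cases b <;> simp [tChristoffel, pd_sqrt dV (h.V_pos x hx), h.pd_zero_V hx]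
  right
  field_simp
  linear_combination (-logPd 0 V x) * hV

/-- Energy density and pressure of a perfect fluid solution, and the remaining field equation. -/
theorem einstein_components (h : IsTFields k V Φ Ω U) {Λ : ℝ} {u : E4 → E4} {ρ p : E4 → ℝ}
    (hu : ∀ y, u y = Pi.single 0 (Real.sqrt (V y)))
    (hE : SolvesEinsteinPerfectFluid Λ (fieldMetric k V Φ Ω) U u ρ p) {x : E4} (hx : x ∈ U) :
    ρ x + Λ = V x * (2 * logPd 0 Ω x * halfLogPd Φ x + halfLogPd Φ x ^ 2) + k / Φ x ∧
    p x - Λ = -(V x * (2 * pd 0 (halfLogPd Φ) x + logPd 0 V x * halfLogPd Φ x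
      + 3 * halfLogPd Φ x ^ 2)) - k / Φ x ∧
    p x - Λ = -(V x * (pd 0 (logPd 0 Ω) x + pd 0 (halfLogPd Φ) x
      + logPd 0 V x / 2 * (logPd 0 Ω x + halfLogPd Φ x)
      + logPd 0 Ω x ^ 2 + halfLogPd Φ x ^ 2 + logPd 0 Ω x * halfLogPd Φ x)) := by
  have hs := (Real.sqrt_pos.2 (h.V_pos x hx)).ne'
  have hV := Real.mul_self_sqrt (h.V_pos x hx).le
  have hV' := (h.V_pos x hx).ne'
  have hΦ := (h.Φ_pos x hx).ne'
  have hΩ := h.Ω_ne x hx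
  have hC := h.conf_ne hx
  have e0 := hE x hx 0 0
  have e1 := hE x hx 1 1
  have e2 := hE x hx 2 2
  have hg : ∀ a b, fieldMetric k V Φ Ω x a b = Matrix.diagonal ![-(1 / V x), Ω x ^ 2,
    Φ x * confFactor k x ^ 2, Φ x * confFactor k x ^ 2] a b := fun a b => rfl
  simp only [einstein, h.lower_eq hx (hu x), h.scalarCurv_eq hx, hg] at e0 e1 e2
  rw [h.ricci_zero_zero hx] at e0
  rw [h.ricci_one_one hx] at e1
  rw [h.ricci_two_two hx] at e2
  have hsq : (Real.sqrt (V x))⁻¹ * (Real.sqrt (V x))⁻¹ = (V x)⁻¹ := by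
    rw [← mul_inv, hV]
  simp at e0 e1 e2
  rw [mul_assoc (ρ x + p x), hsq] at e0
  refine ⟨?_, ?_, ?_⟩
  · field_simp at e0 ⊢
    linear_combination (-1 / 2) * e0
  · field_simp at e1 ⊢
    linear_combination (-1 / 2) * e1
  · field_simp at e2
    apply mul_left_cancel₀ hΦ
    linear_combination (-1 / 2) * e2

end IsTFields

/-! ### Fields depending on time only -/

theorem differentiableAt_div {f g : E4 → ℝ} {x : E4} (hf : DifferentiableAt ℝ f x)
    (hg : DifferentiableAt ℝ g x) (h0 : g x ≠ 0) : DifferentiableAt ℝ (fun y => f y / g y) x := by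
  simpa only [div_eq_mul_inv] using hf.fun_mul (hg.fun_inv h0)

/-- Smooth fields depending (locally) on the time coordinate only. -/
structure IsTimeField (f : E4 → ℝ) (U : Set E4) : Prop where
  smooth : SmoothOn f U
  pd_eq : ∀ x ∈ U, ∀ i, i ≠ 0 → pd i f x = 0

namespace IsTimeField

variable {f g : E4 → ℝ} {U : Set E4}

theorem const (c : ℝ) (U : Set E4) : IsTimeField (fun _ => c) U :=
  ⟨smoothOn_const c U, fun x _ i _ => pd_const c i x⟩

theorem add (hU : IsOpen U) (hf : IsTimeField f U) (hg : IsTimeField g U) :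
    IsTimeField (fun x => f x + g x) U :=
  ⟨hf.smooth.add hg.smooth, fun x hx i hi => by
    rw [pd_add (hf.smooth.differentiableAt hU hx) (hg.smooth.differentiableAt hU hx),
      hf.pd_eq x hx i hi, hg.pd_eq x hx i hi, add_zero]⟩

theorem mul (hU : IsOpen U) (hf : IsTimeField f U) (hg : IsTimeField g U) :
    IsTimeField (fun x => f x * g x) U :=
  ⟨hf.smooth.mul hg.smooth, fun x hx i hi => by
    rw [pd_mul (hf.smooth.differentiableAt hU hx) (hg.smooth.differentiableAt hU hx),
      hf.pd_eq x hx i hi, hg.pd_eq x hx i hi]; ring⟩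

theorem div (hU : IsOpen U) (hf : IsTimeField f U) (hg : IsTimeField g U)
    (h0 : ∀ x ∈ U, g x ≠ 0) : IsTimeField (fun x => f x / g x) U :=
  ⟨hf.smooth.div hg.smooth h0, fun x hx i hi => by
    rw [pd_div (hf.smooth.differentiableAt hU hx) (hg.smooth.differentiableAt hU hx) (h0 x hx),
      hf.pd_eq x hx i hi, hg.pd_eq x hx i hi]; ring⟩

theorem sqrt (hU : IsOpen U) (hf : IsTimeField f U) (h0 : ∀ x ∈ U, 0 < f x) :
    IsTimeField (fun x => Real.sqrt (f x)) U :=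
  ⟨hf.smooth.sqrt fun x hx => (h0 x hx).ne', fun x hx i hi => by
    rw [pd_sqrt (hf.smooth.differentiableAt hU hx) (h0 x hx), hf.pd_eq x hx i hi, zero_div]⟩

theorem pd_zero (hU : IsOpen U) (hf : IsTimeField f U) : IsTimeField (pd 0 f) U :=
  ⟨hf.smooth.pd hU 0, fun x hx i hi => by
    rw [pd_comm hf.smooth hU hx, pd_congr_on hU (fun y hy => hf.pd_eq y hy i hi) hx, pd_const]⟩

theorem congr (hU : IsOpen U) (hf : IsTimeField f U) (h : ∀ x ∈ U, g x = f x) :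
    IsTimeField g U :=
  ⟨hf.smooth.congr h, fun x hx i hi => by rw [pd_congr_on hU h hx, hf.pd_eq x hx i hi]⟩

end IsTimeField

/-! ### Homogeneity of the expansion and factorisation of ω -/

namespace IsTFields

variable {k : ℝ} {V Φ Ω : E4 → ℝ} {U : Set E4}

theorem isTimeField_V (h : IsTFields k V Φ Ω U) : IsTimeField V U := ⟨h.smooth_V, h.pd_V⟩

theorem isTimeField_Φ (h : IsTFields k V Φ Ω U) : IsTimeField Φ U := ⟨h.smooth_Φ, h.pd_Φ⟩

theorem isTimeField_sqrt_V (h : IsTFields k V Φ Ω U) :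
    IsTimeField (fun x => Real.sqrt (V x)) U := h.isTimeField_V.sqrt h.isOpen h.V_pos

theorem sqrt_V_ne (h : IsTFields k V Φ Ω U) : ∀ x ∈ U, Real.sqrt (V x) ≠ 0 := fun x hx =>
  (Real.sqrt_pos.2 (h.V_pos x hx)).ne'

theorem isTimeField_halfLogPd_Φ (h : IsTFields k V Φ Ω U) : IsTimeField (halfLogPd Φ) U :=
  ⟨h.smooth_halfLogPd_Φ, fun _ hx _ hi => h.pd_halfLogPd_Φ hx hi⟩

theorem isTimeField_lower (h : IsTFields k V Φ Ω U) {u : E4 → E4}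
    (hu : ∀ y, u y = Pi.single 0 (Real.sqrt (V y))) (a : Fin 4) :
    IsTimeField (lower (fieldMetric k V Φ Ω) u a) U := by
  refine IsTimeField.congr (f := fun x => if a = 0 then -1 / Real.sqrt (V x) else 0) h.isOpen ?_
    fun x hx => by rw [h.lower_eq hx (hu x)]; split_ifs <;> ring
  by_cases ha : a = 0
  · simpa [ha] using (IsTimeField.const (-1) U).div h.isOpen h.isTimeField_sqrt_V h.sqrt_V_ne
  · simpa [ha] using IsTimeField.const 0 U

theorem isTimeField_logPd_Ω (h : IsTFields k V Φ Ω U)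
    (h1 : ∀ x ∈ U, pd 1 (logPd 0 Ω) x = 0) : IsTimeField (logPd 0 Ω) U :=
  ⟨h.smooth_logPd_Ω 0, fun x hx i hi => by
    by_cases hi1 : i = 1
    · rw [hi1, h1 x hx]
    · exact h.pd_logPd_Ω hx hi hi1⟩

theorem isTimeField_expansion (h : IsTFields k V Φ Ω U) {u : E4 → E4}
    (hu : ∀ y, u y = Pi.single 0 (Real.sqrt (V y)))
    (h1 : ∀ x ∈ U, pd 1 (logPd 0 Ω) x = 0) :
    IsTimeField (expansion (fieldMetric k V Φ Ω) u) U :=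
  (h.isTimeField_sqrt_V.mul h.isOpen ((h.isTimeField_logPd_Ω h1).add h.isOpen
    ((IsTimeField.const 2 U).mul h.isOpen h.isTimeField_halfLogPd_Φ))).congr h.isOpen
    fun _ hx => h.expansion_eq hx hu

theorem hasHomogeneousExpansionOn (h : IsTFields k V Φ Ω U) {u : E4 → E4}
    (hu : ∀ y, u y = Pi.single 0 (Real.sqrt (V y)))
    (h1 : ∀ x ∈ U, pd 1 (logPd 0 Ω) x = 0) :
    HasHomogeneousExpansionOn (fieldMetric k V Φ Ω) U u := by
  have hlow := fun a x (hx : x ∈ U) => h.lower_eq hx (hu x) a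
  have hθ := h.isTimeField_expansion hu h1
  refine hasHomogeneousExpansionOn_of_closed h.isOpen hθ.smooth
    (fun a => (h.isTimeField_lower hu a).smooth) (fun x hx => ⟨0, ?_⟩) (fun x hx a b => ?_)
    fun x hx => ⟨-(pd 0 (expansion (fieldMetric k V Φ Ω) u) x * Real.sqrt (V x)), fun a => ?_⟩
  · simpa [hlow 0 x hx] using h.sqrt_V_ne x hx
  · have key : ∀ a b : Fin 4, a ≠ b → pd a (lower (fieldMetric k V Φ Ω) u b) x = 0 := by
      intro a b hab
      by_cases ha : a = 0
      · have hb : b ≠ 0 := fun hb => hab (ha.trans hb.symm)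
        rw [pd_congr_on h.isOpen (hlow b) hx]
        simp [hb]
      · exact (h.isTimeField_lower hu b).pd_eq x hx a ha
    by_cases hab : a = b
    · rw [hab]
    · rw [key a b hab, key b a (Ne.symm hab)]
  · by_cases ha : a = 0
    · have := h.sqrt_V_ne x hx
      rw [hlow a x hx, ha, if_pos rfl]; field_simp
    · rw [hlow a x hx, if_neg ha, hθ.pd_eq x hx a ha, mul_zero]

/-- Since u has no r-component, the time function is constant along r-lines, and so is θ. As V and B
depend on time only, A = θ/√V - 2B is constant along them too. -/
theorem pd_logPd_Ω_of_hasHomogeneousExpansionOn (h : IsTFields k V Φ Ω U) {u : E4 → E4}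
    (hu : ∀ y, u y = Pi.single 0 (Real.sqrt (V y)))
    (hh : HasHomogeneousExpansionOn (fieldMetric k V Φ Ω) U u) :
    ∀ x ∈ U, pd 1 (logPd 0 Ω) x = 0 := by
  intro x hx
  obtain ⟨W, hW, hxW, hWU, t, f, ht⟩ := hh x hx
  obtain ⟨r, hr, hball⟩ := Metric.isOpen_iff.1 hW x hxW
  have ht1 : ∀ y ∈ Metric.ball x r, pd 1 t y = 0 := by
    intro y hy
    have := ht.eq_neg_dt y (hball hy) 1
    rw [h.lower_eq (hWU (hball hy)) (hu y)] at this
    simpa using this.symm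
  refine pd_eq_zero_of_line Metric.isOpen_ball (Metric.mem_ball_self hr) 1 fun y hy hline => ?_
  have htxy : t y = t x := eq_of_pd_eq_zero
    (fun z hz => ht.smooth_t.differentiableAt hW (hball hz)) hy (Metric.mem_ball_self hr)
    fun i hi z hz => by
      have : i = 1 := by by_contra h'; exact hi (hline i h')
      rw [this, ht1 z hz]
  have hV : V y = V x := eq_of_pd_eq_zero
    (fun z hz => h.smooth_V.differentiableAt h.isOpen (hWU (hball hz))) hy
    (Metric.mem_ball_self hr) fun i hi z hz => by
      have : i = 1 := by by_contra h'; exact hi (hline i h')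
      rw [this, h.pd_V z (hWU (hball hz)) 1 (by decide)]
  have hB : halfLogPd Φ y = halfLogPd Φ x := eq_of_pd_eq_zero
    (fun z hz => h.smooth_halfLogPd_Φ.differentiableAt h.isOpen (hWU (hball hz))) hy
    (Metric.mem_ball_self hr) fun i hi z hz => by
      have : i = 1 := by by_contra h'; exact hi (hline i h')
      rw [this, h.pd_halfLogPd_Φ (hWU (hball hz)) (by decide)]
  have h1 := ht.expansion_eq y (hball hy)
  have h2 := ht.expansion_eq x hxW
  rw [htxy, ← h2, h.expansion_eq hx hu, h.expansion_eq (hWU (hball hy)) hu, hV, hB] at h1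
  linarith [mul_left_cancel₀ (h.sqrt_V_ne x hx) h1]

/-- For P = log p one has ∂_r P = 0 and ∂_t P = -γ(A + 2B); equality of the mixed derivatives yields
∂_r A = 0. There is no division by θ, so zeros of θ are harmless. -/
theorem pd_logPd_Ω_of_isCIGFlow (h : IsTFields k V Φ Ω U) {u : E4 → E4} {kt cv : ℝ}
    (hu : ∀ y, u y = Pi.single 0 (Real.sqrt (V y))) (hkt : 0 < kt) (hcv : 0 < cv)
    (hc : IsCIGFlow kt cv (fieldMetric k V Φ Ω) U u) :
    ∀ x ∈ U, pd 1 (logPd 0 Ω) x = 0 := by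
  have hU := h.isOpen
  obtain ⟨P, hPs, hP⟩ := hc.exists_log_pressure hU hkt hcv fun x hx => h.accel_eq_zero hx hu
  have hγ : (1 + kt / cv) ≠ 0 := by positivity
  have hP0 : ∀ y ∈ U, logPd 0 Ω y = -(1 + kt / cv)⁻¹ * pd 0 P y + -2 * halfLogPd Φ y := by
    intro y hy
    have := h.sqrt_V_ne y hy
    rw [hP y hy, h.expansion_eq hy hu, h.lower_eq hy (hu y), if_pos rfl]
    field_simp
    ring
  intro x hx
  have d0 := (hPs.pd hU 0).differentiableAt hU hx
  have dB := h.smooth_halfLogPd_Φ.differentiableAt hU hx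
  have hP1 : ∀ y ∈ U, pd 1 P y = 0 := by
    intro y hy
    rw [hP y hy, h.lower_eq hy (hu y)]; simp
  rw [pd_congr_on hU hP0 hx, pd_add (d0.const_mul _) (dB.const_mul _), pd_const_mul d0,
    pd_const_mul dB, pd_comm hPs hU hx, pd_congr_on hU hP1 hx, pd_const,
    h.pd_halfLogPd_Φ hx (by decide)]
  simp

/-- Ω(t,r) and Ω(t,r₀) have the same logarithmic time derivative when A does not depend on r, so
their quotient is constant in t. -/
theorem div_update_eq (h : IsTFields k V Φ Ω U) (h1 : ∀ x ∈ U, pd 1 (logPd 0 Ω) x = 0)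
    {x : E4} {r : ℝ} (hr : 0 < r) (hball : Metric.ball x r ⊆ U) {y : E4}
    (hy : y ∈ Metric.ball x r) :
    Ω y / Ω (Function.update y 1 (x 1)) = Ω (Function.update y 0 (x 0)) /
      Ω (Function.update (Function.update y 0 (x 0)) 1 (x 1)) := by
  have hU := h.isOpen
  have hx := Metric.mem_ball_self (x := x) hr
  have dΩ : ∀ z ∈ Metric.ball x r, DifferentiableAt ℝ Ω z := fun z hz =>
    h.smooth_Ω.differentiableAt hU (hball hz)
  have hupd : ∀ z ∈ Metric.ball x r, Function.update z 1 (x 1) ∈ Metric.ball x r := fun z hz =>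
    update_mem_ball hz hx 1
  have dupd : ∀ z : E4, DifferentiableAt ℝ (fun z : E4 => Function.update z 1 (x 1)) z := by
    intro z
    rw [differentiableAt_pi]
    intro j
    by_cases hj : j = 1
    · subst hj; simp
    · simp only [Function.update_of_ne hj]; fun_prop
  have dN : ∀ z ∈ Metric.ball x r,
      DifferentiableAt ℝ (fun z : E4 => Ω (Function.update z 1 (x 1))) z := fun z hz =>
    DifferentiableAt.comp z (dΩ _ (hupd z hz)) (dupd z)
  refine eq_of_pd_eq_zero (f := fun z => Ω z / Ω (Function.update z 1 (x 1)))
    (fun z hz => differentiableAt_div (dΩ z hz) (dN z hz) (h.Ω_ne _ (hball (hupd z hz)))) hy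
    (update_mem_ball hy hx 0) fun i hi z hz => ?_
  have hi0 : i = 0 := by
    by_contra h'
    exact hi (by simp [h'])
  subst hi0
  have hN0 : pd 0 (fun z : E4 => Ω (Function.update z 1 (x 1))) z
      = pd 0 Ω (Function.update z 1 (x 1)) := by
    refine (pd_eq_deriv_update (dN z hz) 0).unique ?_
    have := pd_eq_deriv_update (dΩ _ (hupd z hz)) 0
    simpa [Function.update_comm (show (0 : Fin 4) ≠ 1 by decide)] using this
  have hA : logPd 0 Ω z = logPd 0 Ω (Function.update z 1 (x 1)) :=
    eq_of_pd_eq_zero (fun z hz => (h.smooth_logPd_Ω 0).differentiableAt hU (hball hz)) hz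
      (hupd z hz) fun i hi q hq =>
      (h.isTimeField_logPd_Ω h1).pd_eq q (hball hq) i fun h' => hi (by simp [h'])
  rw [pd_div (dΩ z hz) (dN z hz) (h.Ω_ne _ (hball (hupd z hz))), hN0,
    h.pd_zero_Ω (hball hz), h.pd_zero_Ω (hball (hupd z hz)), hA]
  ring

/-- If `Ω / √Φ` does not depend on time, then `logPd 0 Ω = halfLogPd Φ`. -/
theorem logPd_eq_halfLogPd (h : IsTFields k V Φ Ω U) {W : Set E4} (hW : IsOpen W) (hWU : W ⊆ U)
    (hL : ∀ x ∈ W, ∀ y ∈ W, (∀ j, j ≠ 0 → y j = x j) → Ω y ^ 2 / Φ y = Ω x ^ 2 / Φ x) :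
    ∀ x ∈ W, logPd 0 Ω x = halfLogPd Φ x := by
  intro x hx
  have hxU := hWU hx
  have dΩ := h.smooth_Ω.differentiableAt h.isOpen hxU
  have dΦ := h.smooth_Φ.differentiableAt h.isOpen hxU
  have hΦ := (h.Φ_pos x hxU).ne'
  have hΩ := h.Ω_ne x hxU
  have := pd_eq_zero_of_line hW hx 0 (hL x hx)
  rw [pd_div (dΩ.fun_pow 2) dΦ hΦ, pd_sq dΩ, h.pd_zero_Ω hxU, h.pd_zero_Φ hxU] at this
  field_simp at this
  simp at this
  rcases this with h' | h'
  · exact absurd h' hΩ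
  · linarith

theorem div_sqrt_eq (h : IsTFields k V Φ Ω U) {x : E4} {r : ℝ} (hr : 0 < r)
    (hball : Metric.ball x r ⊆ U)
    (hAB : ∀ y ∈ Metric.ball x r, logPd 0 Ω y = halfLogPd Φ y) {y : E4}
    (hy : y ∈ Metric.ball x r) :
    Ω y / Real.sqrt (Φ y) = Ω (Function.update y 0 (x 0)) /
      Real.sqrt (Φ (Function.update y 0 (x 0))) := by
  have hU := h.isOpen
  have hs : ∀ z ∈ U, Real.sqrt (Φ z) ≠ 0 := fun z hz => (Real.sqrt_pos.2 (h.Φ_pos z hz)).ne'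
  have dΩ : ∀ z ∈ U, DifferentiableAt ℝ Ω z := fun z hz => h.smooth_Ω.differentiableAt hU hz
  have dΦ : ∀ z ∈ U, DifferentiableAt ℝ Φ z := fun z hz => h.smooth_Φ.differentiableAt hU hz
  have ds : ∀ z ∈ U, DifferentiableAt ℝ (fun z => Real.sqrt (Φ z)) z := fun z hz =>
    (dΦ z hz).sqrt (h.Φ_pos z hz).ne'
  refine eq_of_pd_eq_zero (f := fun z => Ω z / Real.sqrt (Φ z))
    (fun z hz => differentiableAt_div (dΩ z (hball hz)) (ds z (hball hz)) (hs z (hball hz))) hy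
    (update_mem_ball hy (Metric.mem_ball_self hr) 0) fun i hi z hz => ?_
  have hi0 : i = 0 := by
    by_contra h'
    exact hi (by simp [h'])
  subst hi0
  have hz' := hball hz
  have hsq := Real.mul_self_sqrt (h.Φ_pos z hz').le
  have hsz := hs z hz'
  rw [pd_div (dΩ z hz') (ds z hz') hsz, pd_sqrt (dΦ z hz') (h.Φ_pos z hz'), h.pd_zero_Ω hz',
    h.pd_zero_Φ hz', hAB z hz]
  field_simp
  linear_combination (Ω z * halfLogPd Φ z) * hsq

end IsTFields

/-! ### Homogeneity, barotropy and the FLRW/KCKS alternative for T-models -/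

namespace IsTModel

variable {Λ k : ℝ} {v φ : ℝ → ℝ} {w : ℝ → ℝ → ℝ} {U : Set E4} {ρ p : E4 → ℝ}

theorem isTFields (h : IsTModel Λ k v φ w U ρ p) :
    IsTFields k (fun x => v (x 0)) (fun x => φ (x 0)) (fun x => w (x 0) (x 1)) U where
  isOpen := h.isOpen
  C_ne := h.C_ne
  V_pos := h.v_pos
  Φ_pos := h.φ_pos
  Ω_ne := h.w_ne
  smooth_V := h.smooth_v
  smooth_Φ := h.smooth_φ
  smooth_Ω := h.smooth_w
  pd_V := fun x hx i hi => pd_eq_zero_of_line h.isOpen hx i fun y _ hl => by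
    rw [hl 0 (Ne.symm hi)]
  pd_Φ := fun x hx i hi => pd_eq_zero_of_line h.isOpen hx i fun y _ hl => by
    rw [hl 0 (Ne.symm hi)]
  pd_Ω := fun x hx i hi hi1 => pd_eq_zero_of_line h.isOpen hx i fun y _ hl => by
    rw [hl 0 (Ne.symm hi), hl 1 (Ne.symm hi1)]

theorem einstein_components (h : IsTModel Λ k v φ w U ρ p) {x : E4} (hx : x ∈ U) :
    ρ x + Λ = v (x 0) * (2 * logPd 0 (fun y => w (y 0) (y 1)) x * halfLogPd (fun y => φ (y 0)) x
      + halfLogPd (fun y => φ (y 0)) x ^ 2) + k / φ (x 0) ∧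
    p x - Λ = -(v (x 0) * (2 * pd 0 (halfLogPd fun y => φ (y 0)) x
      + logPd 0 (fun y => v (y 0)) x * halfLogPd (fun y => φ (y 0)) x
      + 3 * halfLogPd (fun y => φ (y 0)) x ^ 2)) - k / φ (x 0) ∧
    p x - Λ = -(v (x 0) * (pd 0 (logPd 0 fun y => w (y 0) (y 1)) x
      + pd 0 (halfLogPd fun y => φ (y 0)) x
      + logPd 0 (fun y => v (y 0)) x / 2 *
        (logPd 0 (fun y => w (y 0) (y 1)) x + halfLogPd (fun y => φ (y 0)) x)
      + logPd 0 (fun y => w (y 0) (y 1)) x ^ 2 + halfLogPd (fun y => φ (y 0)) x ^ 2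
      + logPd 0 (fun y => w (y 0) (y 1)) x * halfLogPd (fun y => φ (y 0)) x)) :=
  h.isTFields.einstein_components (fun _ => rfl) h.einstein_eq hx

/-- The rr field equation expresses p through v, φ and their time derivatives, without ω. -/
theorem isTimeField_p (h : IsTModel Λ k v φ w U ρ p) : IsTimeField p U := by
  have hF := h.isTFields
  have hU := h.isOpen
  have hB := hF.isTimeField_halfLogPd_Φ
  have hV := hF.isTimeField_V
  have hΦ := hF.isTimeField_Φ
  have c := fun c : ℝ => IsTimeField.const c U
  have hZ : IsTimeField (logPd 0 fun x : E4 => v (x 0)) U :=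
    (hV.pd_zero hU).div hU hV fun x hx => (h.v_pos x hx).ne'
  refine ((c Λ).add hU (((c (-1)).mul hU (hV.mul hU ((((c 2).mul hU (hB.pd_zero hU)).add hU
    (hZ.mul hU hB)).add hU ((c 3).mul hU (hB.mul hU hB))))).add hU
    ((c (-k)).div hU hΦ fun x hx => (h.φ_pos x hx).ne'))).congr hU fun x hx => ?_
  have := (h.einstein_components hx).2.1
  linear_combination this

theorem isTimeField_ρ (h : IsTModel Λ k v φ w U ρ p)
    (h1 : ∀ x ∈ U, pd 1 (logPd 0 fun x : E4 => w (x 0) (x 1)) x = 0) : IsTimeField ρ U := by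
  have hF := h.isTFields
  have hU := h.isOpen
  have hB := hF.isTimeField_halfLogPd_Φ
  have hA := hF.isTimeField_logPd_Ω h1
  have hV := hF.isTimeField_V
  have hΦ := hF.isTimeField_Φ
  have c := fun c : ℝ => IsTimeField.const c U
  refine ((c (-Λ)).add hU ((hV.mul hU ((((c 2).mul hU hA).mul hU hB).add hU (hB.mul hU hB))).add hU
    ((c k).div hU hΦ fun x hx => (h.φ_pos x hx).ne'))).congr hU fun x hx => ?_
  have := (h.einstein_components hx).1
  linear_combination this

theorem isBarotropicOn (h : IsTModel Λ k v φ w U ρ p)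
    (hh : HasHomogeneousExpansionOn (tMetric k v φ w) U (tVelocity v)) :
    IsBarotropicOn U ρ p := by
  have h1 := h.isTFields.pd_logPd_Ω_of_hasHomogeneousExpansionOn (fun _ => rfl) hh
  have hp := h.isTimeField_p
  have hρ := h.isTimeField_ρ h1
  intro x hx a b
  by_cases ha : a = 0
  · by_cases hb : b = 0
    · rw [ha, hb]; ring
    · rw [hp.pd_eq x hx b hb, hρ.pd_eq x hx b hb]; ring
  · rw [hp.pd_eq x hx a ha, hρ.pd_eq x hx a ha]; ring

theorem factorization (h : IsTModel Λ k v φ w U ρ p)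
    (h1 : ∀ x ∈ U, pd 1 (logPd 0 fun x : E4 => w (x 0) (x 1)) x = 0) {x : E4} {r : ℝ} (hr : 0 < r)
    (hball : Metric.ball x r ⊆ U) {y : E4} (hy : y ∈ Metric.ball x r) :
    w (y 0) (y 1) = w (y 0) (x 1) * (w (x 0) (y 1) / w (x 0) (x 1)) := by
  have hd := h.isTFields.div_update_eq h1 hr hball hy
  have hne : w (y 0) (x 1) ≠ 0 := by
    simpa using h.w_ne _ (hball (update_mem_ball hy (Metric.mem_ball_self hr) 1))
  simp at hd
  rw [← hd, mul_div_cancel₀ _ hne]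

theorem isHomogeneousTModel (h : IsTModel Λ k v φ w U ρ p)
    (h1 : ∀ x ∈ U, pd 1 (logPd 0 fun x : E4 => w (x 0) (x 1)) x = 0) :
    IsHomogeneousTModel w U := by
  intro x hx
  obtain ⟨r, hr, hball⟩ := Metric.isOpen_iff.1 h.isOpen x hx
  exact ⟨_, Metric.isOpen_ball, Metric.mem_ball_self hr, hball, fun t => w t (x 1),
    fun r => w (x 0) r / w (x 0) (x 1), fun y hy => h.factorization h1 hr hball hy⟩

theorem isFLRWForm_or_isKCKSForm (h : IsTModel Λ k v φ w U ρ p)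
    (h1 : ∀ x ∈ U, pd 1 (logPd 0 fun x : E4 => w (x 0) (x 1)) x = 0) {x : E4} (hx : x ∈ U) :
    ∃ W : Set E4, IsOpen W ∧ x ∈ W ∧ W ⊆ U ∧ (IsFLRWForm k φ w W ∨ IsKCKSForm φ w W) := by
  have hF := h.isTFields
  obtain ⟨r, hr, hball⟩ := Metric.isOpen_iff.1 h.isOpen x hx
  have hxB := Metric.mem_ball_self (x := x) hr
  refine ⟨_, Metric.isOpen_ball, hxB, hball, ?_⟩
  have hfac := fun y hy => h.factorization h1 hr hball (y := y) hy
  -- The factor F is w(·, r₀). If F² is proportional to φ, then w²/φ depends on r alone, so A = B.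
  by_cases hc : ∃ c : ℝ, ∀ y ∈ Metric.ball x r, w (y 0) (x 1) ^ 2 = c * φ (y 0)
  swap
  · exact Or.inr ⟨fun t => w t (x 1), fun r => w (x 0) r / w (x 0) (x 1), hfac, hc⟩
  left
  obtain ⟨c, hc⟩ := hc
  have hAB := hF.logPd_eq_halfLogPd (Metric.isOpen_ball (x := x) (ε := r)) hball
    (fun y hy z hz hl => by
      have key : ∀ q ∈ Metric.ball x r, w (q 0) (q 1) ^ 2 / φ (q 0)
          = c * (w (x 0) (q 1) / w (x 0) (x 1)) ^ 2 := by
        intro q hq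
        rw [hfac q hq, mul_pow, hc q hq]
        have := (h.φ_pos q (hball hq)).ne'
        field_simp
      change w (z 0) (z 1) ^ 2 / φ (z 0) = w (y 0) (y 1) ^ 2 / φ (y 0)
      rw [key z hz, key y hy, hl 1 (by decide)])
  refine ⟨?_, fun r => w (x 0) r / Real.sqrt (φ (x 0)), fun y hy => ?_⟩
  -- With A = B the two expressions for p differ exactly by k/φ.
  · obtain ⟨-, e1, e2⟩ := h.einstein_components hx
    have hd := pd_congr_on (Metric.isOpen_ball (x := x) (ε := r)) hAB hxB 0
    rw [hd, hAB x hxB] at e2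
    have hk : k / φ (x 0) = 0 := by linear_combination e1 - e2
    exact (div_eq_zero_iff.1 hk).resolve_right (h.φ_pos x hx).ne'
  · have hd := hF.div_sqrt_eq hr hball hAB hy
    have hs := (Real.sqrt_pos.2 (h.φ_pos y (hball hy))).ne'
    simp at hd
    beta_reduce
    rw [← hd, mul_div_cancel₀ _ hs]

theorem hasHomogeneousExpansionOn_of_isBarotropicOn (h : IsTModel Λ k v φ w U ρ p)
    (hb : IsBarotropicOn U ρ p) (h0 : ∀ x ∈ U, pd 0 p x ≠ 0 ∧ deriv φ (x 0) ≠ 0) :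
    HasHomogeneousExpansionOn (tMetric k v φ w) U (tVelocity v) := by
  have hF := h.isTFields
  have hU := h.isOpen
  refine hF.hasHomogeneousExpansionOn (fun _ => rfl) fun x hx => ?_
  have hB := hF.isTimeField_halfLogPd_Φ
  have hV := hF.isTimeField_V
  have hΦ := hF.isTimeField_Φ
  have c := fun c : ℝ => IsTimeField.const c U
  -- The (r,t) component of dρ ∧ dp, with ∂_r p = 0 and ∂_t p ≠ 0.
  have hρ1 : pd 1 ρ x = 0 := by
    have := hb x hx 1 0
    rw [h.isTimeField_p.pd_eq x hx 1 (by decide), mul_zero, sub_zero] at this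
    exact (mul_eq_zero.1 this).resolve_right (h0 x hx).1
  have hT := (c 2).mul hU (hV.mul hU hB)
  have hS := (c (-Λ)).add hU ((hV.mul hU (hB.mul hU hB)).add hU
    ((c k).div hU hΦ fun x hx => (h.φ_pos x hx).ne'))
  have dA := (hF.smooth_logPd_Ω 0).differentiableAt hU hx
  have dT := hT.smooth.differentiableAt hU hx
  have dS := hS.smooth.differentiableAt hU hx
  -- The density is 2vB·A plus a function of time, so ∂_r ρ = 0 becomes 2vB ∂_r A = 0.
  rw [pd_congr_on hU (fun y hy => by
    have := (h.einstein_components hy).1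
    linear_combination this) hx (g := fun y => logPd 0 (fun x : E4 => w (x 0) (x 1)) y *
      (2 * (v (y 0) * halfLogPd (fun x : E4 => φ (x 0)) y)) + (-Λ + (v (y 0) *
      (halfLogPd (fun x : E4 => φ (x 0)) y * halfLogPd (fun x : E4 => φ (x 0)) y) + k / φ (y 0)))),
    pd_add (dA.fun_mul dT) dS, pd_mul dA dT, hT.pd_eq x hx 1 (by decide),
    hS.pd_eq x hx 1 (by decide), mul_zero, add_zero, add_zero] at hρ1
  refine (mul_eq_zero.1 hρ1).resolve_right (mul_ne_zero two_ne_zero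
    (mul_ne_zero (h.v_pos x hx).ne' (div_ne_zero ?_
      (mul_ne_zero two_ne_zero (h.φ_pos x hx).ne'))))
  have hdφ : HasDerivAt φ (deriv φ (x 0)) (x 0) :=
    (differentiableAt_of_deriv_ne_zero (h0 x hx).2).hasDerivAt
  rw [pd_comp hdφ (f := fun x : E4 => x 0) (by fun_prop), pd_coord]
  simpa using (h0 x hx).2

end IsTModel

/-! ### Ideal T-models and the indicatrix functions -/

theorem eq_of_chiIdealT_eq_chiCIG {γ' γ π : ℝ} (hγ' : 1 < γ') (h0 : π ≠ 0) (h1 : π + 1 ≠ 0)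
    (h2 : π + γ' - 1 ≠ 0) (h : chiIdealT γ' π = chiCIG γ π) :
    π = γ * (γ' - 1) / (2 * γ' - γ) := by
  have key : (2 * γ' - γ) * π = γ * (γ' - 1) := by
    unfold chiIdealT chiCIG at h
    field_simp at h
    linear_combination h
  have hne : 2 * γ' - γ ≠ 0 := by
    -- If γ = 2γ', the relation would give γ(γ'-1) = 0, impossible for γ' > 1.
    intro h'
    rw [h', zero_mul] at key
    rcases mul_eq_zero.1 key.symm with h'' | h'' <;> linarith
  rw [eq_div_iff hne]
  linear_combination key

theorem exists_chiIdealT_ne_chiCIG {γ' γ a b : ℝ} (hγ' : 1 < γ') (hab : a < b) :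
    ∃ π ∈ Set.Ioo a b, chiIdealT γ' π ≠ chiCIG γ π := by
  by_contra! h
  -- Coincidence is possible only at the common zero, at the poles (where division by zero is 0 by
  -- convention), or at the single solution of the linear equation.
  refine Set.Ioo_infinite hab ((Set.toFinite
    {0, -1, 1 - γ', γ * (γ' - 1) / (2 * γ' - γ)}).subset fun π hπ => ?_)
  by_contra! hn
  simp only [Set.mem_insert_iff, Set.mem_singleton_iff, not_or] at hn
  obtain ⟨h0, h1, h2, h3⟩ := hn
  exact h3 (eq_of_chiIdealT_eq_chiCIG hγ' h0 (fun h' => h1 (by linarith))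
    (fun h' => h2 (by linarith)) (h π hπ))

theorem hasDerivAt_abs_rpow {τ : ℝ} (hτ : τ ≠ 0) (a : ℝ) :
    HasDerivAt (fun t : ℝ => |t| ^ a) (a * |τ| ^ a / τ) τ := by
  have hexp : ∀ t : ℝ, t ≠ 0 → |t| ^ a = Real.exp (Real.log t * a) := fun t ht => by
    rw [Real.rpow_def_of_pos (abs_pos.2 ht), Real.log_abs]
  have h := ((Real.hasDerivAt_log hτ).mul_const a).exp
  rw [← hexp τ hτ] at h
  refine (h.congr_of_eventuallyEq ?_).congr_deriv (by ring)
  filter_upwards [isOpen_ne.mem_nhds hτ] with t ht using hexp t ht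

/-- The nonzero derivative is what lets Q be recovered from A = B + α'/(α + Q). -/
theorem exists_hasDerivAt_idealα {γ' τ : ℝ} (hγ' : γ' ≠ 0) (hτ : τ ≠ 0) :
    ∃ α' : ℝ, α' ≠ 0 ∧ HasDerivAt (idealα γ') α' τ := by
  by_cases h2 : γ' = 2
  · refine ⟨τ⁻¹, inv_ne_zero hτ, ?_⟩
    have : idealα γ' = Real.log := by
      funext t; simp [idealα, h2, Real.log_abs]
    rw [this]
    exact Real.hasDerivAt_log hτ
  · refine ⟨(1 - 2 / γ') * |τ| ^ (1 - 2 / γ') / τ, ?_, ?_⟩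
    · refine div_ne_zero (mul_ne_zero ?_ (Real.rpow_pos_of_pos (abs_pos.2 hτ) _).ne') hτ
      rw [sub_ne_zero, ne_comm, Ne, div_eq_one_iff_eq hγ']
      exact fun h' => h2 h'.symm
    · have : idealα γ' = fun t => |t| ^ (1 - 2 / γ') := by
        funext t; simp [idealα, h2]
      rw [this]
      exact hasDerivAt_abs_rpow hτ _

theorem along_one_velocity (q : E4 → ℝ) (x : E4) :
    along (tVelocity fun _ => 1) q x = pd 0 q x := by
  simp [along, tVelocity, Pi.single_apply]

namespace IsIdealTModel

variable {γ' : ℝ} {Q : ℝ → ℝ} {U : Set E4} {ρ p : E4 → ℝ}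

theorem time_ne_zero (h : IsIdealTModel γ' Q U ρ p) {x : E4} (hx : x ∈ U) : x 0 ≠ 0 := by
  intro h0
  have := h.isTModel.φ_pos x hx
  have hγ := h.one_lt
  -- The exponent is positive, so φ vanishes at τ = 0.
  rw [h0, idealφ, abs_zero, Real.zero_rpow (by positivity)] at this
  exact lt_irrefl _ this

theorem halfLogPd_eq (h : IsIdealTModel γ' Q U ρ p) {x : E4} (hx : x ∈ U) :
    halfLogPd (fun y => idealφ γ' (y 0)) x = 2 / (3 * γ') * (x 0)⁻¹ := by
  have hτ := h.time_ne_zero hx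
  have hφ := (h.isTModel.φ_pos x hx).ne'
  have hγ : γ' ≠ 0 := by linarith [h.one_lt]
  rw [halfLogPd, pd_comp (h := idealφ γ') (hasDerivAt_abs_rpow hτ _)
    (f := fun y : E4 => y 0) (by fun_prop), pd_coord, if_pos rfl]
  change 4 / (3 * γ') * idealφ γ' (x 0) / x 0 * 1 / _ = _
  field_simp
  ring

theorem pd_halfLogPd_eq (h : IsIdealTModel γ' Q U ρ p) {x : E4} (hx : x ∈ U) :
    pd 0 (halfLogPd fun y => idealφ γ' (y 0)) x = -(2 / (3 * γ') * (x 0)⁻¹ ^ 2) := by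
  have hd : DifferentiableAt ℝ (fun y : E4 => y 0) x := by fun_prop
  have hτ := h.time_ne_zero hx
  rw [pd_congr_on h.isTModel.isOpen (fun y hy => h.halfLogPd_eq hy) hx,
    pd_const_mul (hd.fun_inv hτ), pd_inv hd hτ, pd_coord]
  simp
  ring

theorem logPd_eq (h : IsIdealTModel γ' Q U ρ p) {x : E4} (hx : x ∈ U) {α' : ℝ}
    (hα : HasDerivAt (idealα γ') α' (x 0)) :
    idealα γ' (x 0) + Q (x 1) ≠ 0 ∧
    logPd 0 (fun y => idealw γ' Q (y 0) (y 1)) x = 2 / (3 * γ') * (x 0)⁻¹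
      + α' / (idealα γ' (x 0) + Q (x 1)) := by
  have hτ := h.time_ne_zero hx
  have hφ := h.isTModel.φ_pos x hx
  have hw := h.isTModel.w_ne x hx
  have hγ : γ' ≠ 0 := by linarith [h.one_lt]
  have hs := (Real.sqrt_pos.2 hφ).ne'
  have hsq := Real.mul_self_sqrt hφ.le
  have hβ : idealα γ' (x 0) + Q (x 1) ≠ 0 := right_ne_zero_of_mul hw
  refine ⟨hβ, ?_⟩
  have h1 := pd_eq_deriv_update (h.isTModel.smooth_w.differentiableAt h.isTModel.isOpen hx) 0
  have h2 : HasDerivAt (fun s => idealw γ' Q s (x 1)) _ (x 0) :=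
    ((hasDerivAt_abs_rpow hτ (4 / (3 * γ'))).sqrt
      (show |x 0| ^ (4 / (3 * γ')) ≠ 0 from hφ.ne')).mul (hα.add_const (Q (x 1)))
  simp only [Function.update_self, Function.update_of_ne (show (1 : Fin 4) ≠ 0 by decide)] at h1
  rw [logPd, h1.unique h2]
  simp only [idealw, idealφ] at hs hsq hφ ⊢
  field_simp
  rw [sq, hsq]
  ring

/-- Density, pressure and their time derivatives in an ideal T-model, with `s = 1 / τ` and
`A = ∂_τ log w`. -/
theorem density_pressure (h : IsIdealTModel γ' Q U ρ p) {x : E4} (hx : x ∈ U) {s A : ℝ}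
    (hs : s = (x 0)⁻¹) (hA : A = logPd 0 (fun y => idealw γ' Q (y 0) (y 1)) x) :
    ρ x = 2 / (3 * γ') * s * (2 * A + 2 / (3 * γ') * s) ∧
    p x = 2 / (3 * γ') * s ^ 2 * (2 * (γ' - 1) / γ') ∧
    pd 0 p x = -2 * s * p x ∧
    pd 0 ρ x = -(ρ x + p x) * (A + 2 * (2 / (3 * γ') * s)) := by
  have hU := h.isTModel.isOpen
  have hF := h.isTModel.isTFields
  have hγ : γ' ≠ 0 := by linarith [h.one_lt]
  have hd : DifferentiableAt ℝ (fun y : E4 => y 0) x := by fun_prop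
  have hτ := h.time_ne_zero hx
  have hρ : ∀ y ∈ U, ρ y = 2 * logPd 0 (fun y => idealw γ' Q (y 0) (y 1)) y *
      halfLogPd (fun y => idealφ γ' (y 0)) y + halfLogPd (fun y => idealφ γ' (y 0)) y ^ 2 := by
    intro y hy
    have := (h.isTModel.einstein_components hy).1
    linear_combination this
  have hp : ∀ y ∈ U, p y = 2 / (3 * γ') * (2 * (γ' - 1) / γ') * (y 0)⁻¹ ^ 2 := by
    intro y hy
    have := (h.isTModel.einstein_components hy).2.1
    rw [h.pd_halfLogPd_eq hy, h.halfLogPd_eq hy] at this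
    simp only [logPd, pd_const] at this
    have e : p y = 2 * (2 / (3 * γ') * (y 0)⁻¹ ^ 2) - 3 * (2 / (3 * γ') * (y 0)⁻¹) ^ 2 := by
      linear_combination this
    rw [e]
    field_simp
  have hA' : pd 0 (logPd 0 fun y => idealw γ' Q (y 0) (y 1)) x =
      -(2 / (3 * γ') * s ^ 2) + 2 * (2 / (3 * γ') * s) ^ 2 - A ^ 2 - A * (2 / (3 * γ') * s) := by
    obtain ⟨-, e1, e2⟩ := h.isTModel.einstein_components hx
    rw [h.pd_halfLogPd_eq hx, h.halfLogPd_eq hx, ← hs] at e1 e2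
    simp only [logPd, pd_const] at e1
    rw [← hA] at e2
    have : logPd 0 (fun _ : E4 => (1 : ℝ)) x = 0 := by simp [logPd]
    rw [this] at e2
    linear_combination e2 - e1
  have dA := (hF.smooth_logPd_Ω 0).differentiableAt hU hx
  have dB := hF.smooth_halfLogPd_Φ.differentiableAt hU hx
  have hρx : ρ x = 2 / (3 * γ') * s * (2 * A + 2 / (3 * γ') * s) := by
    rw [hρ x hx, h.halfLogPd_eq hx, ← hs, ← hA]; ring
  have hpx : p x = 2 / (3 * γ') * s ^ 2 * (2 * (γ' - 1) / γ') := by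
    rw [hp x hx, ← hs]; ring
  refine ⟨hρx, hpx, ?_, ?_⟩
  · rw [hpx, pd_congr_on hU hp hx, pd_const_mul ((hd.fun_inv hτ).fun_pow 2),
      pd_sq (hd.fun_inv hτ), pd_inv hd hτ, pd_coord, hs]
    simp
    ring
  · rw [hρx, hpx, pd_congr_on hU hρ hx, pd_add ((dA.const_mul 2).fun_mul dB) (dB.fun_pow 2),
      pd_mul (dA.const_mul 2) dB, pd_const_mul dA, pd_sq dB, hA', h.pd_halfLogPd_eq hx,
      h.halfLogPd_eq hx, ← hs, ← hA]
    field_simp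
    ring

theorem indicatrix_eq (h : IsIdealTModel γ' Q U ρ p) {x : E4} (hx : x ∈ U) (hρ0 : ρ x ≠ 0)
    (hρ' : pd 0 ρ x ≠ 0) :
    (p x / ρ x ≠ 0 ∧ p x / ρ x + 1 ≠ 0 ∧ p x / ρ x + γ' - 1 ≠ 0) ∧
      pd 0 p x / pd 0 ρ x = chiIdealT γ' (p x / ρ x) := by
  obtain ⟨s, hs⟩ : ∃ s, s = (x 0)⁻¹ := ⟨_, rfl⟩
  obtain ⟨A, hA⟩ : ∃ A, A = logPd 0 (fun y => idealw γ' Q (y 0) (y 1)) x := ⟨_, rfl⟩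
  obtain ⟨hρ, hp, hpd, hρd⟩ := h.density_pressure hx hs hA
  have hs0 : s ≠ 0 := hs ▸ inv_ne_zero (h.time_ne_zero hx)
  have hγ : γ' ≠ 0 := by linarith [h.one_lt]
  have hγ1 : γ' - 1 ≠ 0 := by linarith [h.one_lt]
  rw [hρd] at hρ'
  have hsum : ρ x + p x ≠ 0 := fun h' => hρ' (by rw [h']; ring)
  obtain ⟨θ, hθ⟩ : ∃ θ, θ = A + 2 * (2 / (3 * γ') * s) := ⟨_, rfl⟩
  rw [← hθ] at hρ' hρd
  have hθ0 : θ ≠ 0 := right_ne_zero_of_mul hρ'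
  have hp0 : p x ≠ 0 := by
    rw [hp]
    exact mul_ne_zero (mul_ne_zero (by positivity) (pow_ne_zero 2 hs0)) (by positivity)
  have h1 : p x / ρ x + 1 = (ρ x + p x) / ρ x := by field_simp; ring
  have h2 : p x / ρ x + γ' - 1 = 4 * (γ' - 1) * s * θ / (3 * γ') / ρ x := by
    rw [eq_div_iff hρ0, show (p x / ρ x + γ' - 1) * ρ x = p x + (γ' - 1) * ρ x by
      field_simp; ring, hρ, hp, hθ]
    field_simp
    ring
  refine ⟨⟨div_ne_zero hp0 hρ0, ?_, ?_⟩, ?_⟩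
  · rw [h1]; exact div_ne_zero hsum hρ0
  · rw [h2]; positivity
  · rw [chiIdealT, h1, h2, hpd, hρd]
    have hp2 : 3 * γ' ^ 2 * p x = 4 * (γ' - 1) * s ^ 2 := by
      rw [hp]; field_simp; ring
    field_simp
    linear_combination (-1) * hp2

theorem not_chiCIG (h : IsIdealTModel γ' Q U ρ p) (γ : ℝ) {V : Set E4} (hV : IsOpen V)
    (hne : V.Nonempty) (hVU : V ⊆ U) :
    ¬ ∀ x ∈ V, ρ x ≠ 0 ∧ pd 0 ρ x ≠ 0 ∧ pd 0 p x / pd 0 ρ x = chiCIG γ (p x / ρ x) := by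
  intro hall
  obtain ⟨x, hx⟩ := hne
  have hγ : γ' ≠ 0 := by linarith [h.one_lt]
  have hτ := h.time_ne_zero (hVU hx)
  have hπ : ∀ y ∈ V, p y / ρ y = γ * (γ' - 1) / (2 * γ' - γ) := by
    intro y hy
    obtain ⟨h1, h2, h3⟩ := hall y hy
    obtain ⟨⟨e1, e2, e3⟩, e⟩ := h.indicatrix_eq (hVU hy) h1 h2
    exact eq_of_chiIdealT_eq_chiCIG h.one_lt e1 e2 e3 (e.symm.trans h3)
  have hp0 : ∀ y ∈ V, p y ≠ 0 := fun y hy h0 => by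
    obtain ⟨h1, h2, -⟩ := hall y hy
    exact (h.indicatrix_eq (hVU hy) h1 h2).1.1 (by rw [h0, zero_div])
  obtain ⟨α', hα0, hα⟩ := exists_hasDerivAt_idealα hγ hτ
  have hcont : ContinuousAt (fun s => Function.update x 1 s) (x 1) := by fun_prop
  have hev : ∀ᶠ s in 𝓝 (x 1), Function.update x 1 s ∈ V := by
    apply hcont.eventually_mem
    simpa using hV.mem_nhds hx
  refine h.Q_deriv_ne x (hVU hx) ?_
  have hQ : Q =ᶠ[𝓝 (x 1)] fun _ => Q (x 1) := by
    filter_upwards [hev] with s hs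
    have h0 : Function.update x 1 s 0 = x 0 := by simp
    obtain ⟨hb, hA⟩ := h.logPd_eq (hVU hx) hα
    obtain ⟨hb', hA'⟩ := h.logPd_eq (hVU hs) (h0.symm ▸ hα)
    obtain ⟨r1, r2, -⟩ := h.density_pressure (hVU hx) rfl hA.symm
    obtain ⟨r1', r2', -⟩ := h.density_pressure (hVU hs) rfl hA'.symm
    simp only [h0, Function.update_self] at r1' r2' hb'
    have hpp : p (Function.update x 1 s) = p x := r2'.trans r2.symm
    have hρρ : ρ (Function.update x 1 s) = ρ x := by
      have := (hπ _ hs).trans (hπ x hx).symm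
      rw [hpp, div_eq_div_iff (hall _ hs).1 (hall x hx).1] at this
      exact (mul_left_cancel₀ (hp0 x hx) this).symm
    rw [r1, r1'] at hρρ
    have e := mul_left_cancel₀ (by positivity) hρρ
    have e' : α' / (idealα γ' (x 0) + Q s) = α' / (idealα γ' (x 0) + Q (x 1)) := by linarith
    rw [div_eq_div_iff hb' hb] at e'
    linarith [mul_left_cancel₀ hα0 e']
  rw [hQ.deriv_eq, deriv_const]

end IsIdealTModel

end TModelCIG

open TModelCIG in
theorem mainTheorem7 :
    -- no non-homogeneous T-model represents the evolution of a classical ideal gas,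
    -- nor does its flow admit a comoving test classical ideal gas
    (∀ (Λ k : ℝ) (v φ : ℝ → ℝ) (w : ℝ → ℝ → ℝ) (U : Set E4) (ρ p : E4 → ℝ),
      IsTModel Λ k v φ w U ρ p → ¬ IsHomogeneousTModel w U →
      ∀ kt cv : ℝ, 0 < kt → 0 < cv →
        ¬ RepresentsCIG kt cv (tMetric k v φ w) U (tVelocity v) ρ p ∧
        ¬ IsCIGFlow kt cv (tMetric k v φ w) U (tVelocity v)) ∧
    -- indicatrix of the ideal T-models, and its incompatibility with the classical one
    (∀ (γ' : ℝ) (Q : ℝ → ℝ) (U : Set E4) (ρ p : E4 → ℝ), IsIdealTModel γ' Q U ρ p →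
      (∀ x ∈ U, ρ x ≠ 0 → along (tVelocity fun _ => 1) ρ x ≠ 0 →
        along (tVelocity fun _ => 1) p x / along (tVelocity fun _ => 1) ρ x =
          chiIdealT γ' (p x / ρ x)) ∧
      (∀ (γ : ℝ) (V : Set E4), IsOpen V → V.Nonempty → V ⊆ U →
        ¬ ∀ x ∈ V, ρ x ≠ 0 ∧ along (tVelocity fun _ => 1) ρ x ≠ 0 ∧
          along (tVelocity fun _ => 1) p x / along (tVelocity fun _ => 1) ρ x =
            chiCIG γ (p x / ρ x))) ∧
    (∀ γ' γ a b : ℝ, 1 < γ' → a < b → ∃ π ∈ Set.Ioo a b, chiIdealT γ' π ≠ chiCIG γ π) ∧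
    -- kinematics of classical ideal gases in geodesic and expanding motion
    (∀ (g : E4 → Matrix (Fin 4) (Fin 4) ℝ) (U : Set E4) (u : E4 → E4),
      IsLorentzianOn g U → IsUnitTimelikeOn g U u → IsGeodesicOn g U u →
      (∀ x ∈ U, expansion g u x ≠ 0) →
      ∀ kt cv : ℝ, 0 < kt → 0 < cv →
        (IsCIGFlow kt cv g U u →
          IsVorticityFreeOn g U u ∧ HasHomogeneousExpansionOn g U u) ∧
        (∀ (t : E4 → ℝ) (f : ℝ → ℝ), IsPreconnected U →
          IsSynchronousHomogeneous g U u t f → IsCIGFlow kt cv g U u)) ∧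
    -- for T-models, a classical ideal gas flow has homogeneous expansion, and homogeneous
    -- expansion is tantamount to barotropic evolution and leads to FLRW or KCKS metrics
    (∀ (Λ k : ℝ) (v φ : ℝ → ℝ) (w : ℝ → ℝ → ℝ) (U : Set E4) (ρ p : E4 → ℝ),
      IsTModel Λ k v φ w U ρ p →
        (∀ kt cv : ℝ, 0 < kt → 0 < cv →
          IsCIGFlow kt cv (tMetric k v φ w) U (tVelocity v) →
          HasHomogeneousExpansionOn (tMetric k v φ w) U (tVelocity v)) ∧
        (HasHomogeneousExpansionOn (tMetric k v φ w) U (tVelocity v) →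
          IsBarotropicOn U ρ p ∧
          ∀ x ∈ U, ∃ W : Set E4, IsOpen W ∧ x ∈ W ∧ W ⊆ U ∧
            (IsFLRWForm k φ w W ∨ IsKCKSForm φ w W)) ∧
        (IsBarotropicOn U ρ p → (∀ x ∈ U, pd 0 p x ≠ 0 ∧ deriv φ (x 0) ≠ 0) →
          HasHomogeneousExpansionOn (tMetric k v φ w) U (tVelocity v))) := by
  refine ⟨?_, ?_, fun γ' γ a b hγ' hab => exists_chiIdealT_ne_chiCIG hγ' hab, ?_, ?_⟩
  · intro Λ k v φ w U ρ p h hn kt cv hkt hcv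
    have hflow : ¬ IsCIGFlow kt cv (tMetric k v φ w) U (tVelocity v) := fun hc =>
      hn (h.isHomogeneousTModel
        (h.isTFields.pd_logPd_Ω_of_isCIGFlow (fun _ => rfl) hkt hcv hc))
    exact ⟨fun hc => hflow ⟨ρ, p, hc⟩, hflow⟩
  · intro γ' Q U ρ p h
    simp only [along_one_velocity]
    exact ⟨fun x hx h0 h1 => (h.indicatrix_eq hx h0 h1).2,
      fun γ V hV hne hVU => h.not_chiCIG γ hV hne hVU⟩
  · intro g U u hg hu hgeo hθ kt cv hkt hcv
    exact ⟨fun hc => hc.vorticityFree_and_homogeneous hg hu hgeo hθ hkt hcv,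
      fun t f hc ht => ht.isCIGFlow hg hu hgeo hkt hcv hc⟩
  · intro Λ k v φ w U ρ p h
    refine ⟨fun kt cv hkt hcv hc => h.isTFields.hasHomogeneousExpansionOn (fun _ => rfl)
        (h.isTFields.pd_logPd_Ω_of_isCIGFlow (fun _ => rfl) hkt hcv hc),
      fun hh => ⟨h.isBarotropicOn hh, fun x hx => h.isFLRWForm_or_isKCKSForm
        (h.isTFields.pd_logPd_Ω_of_hasHomogeneousExpansionOn (fun _ => rfl) hh) hx⟩,
      fun hb h0 => h.hasHomogeneousExpansionOn_of_isBarotropicOn hb h0⟩
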